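/- **Lemma 7.** A server and $n\ge 2$ nodes, with honest set $\mathcal H$ and Byzantine set $\mathcal B$, $|\mathcal B|<|\mathcal H|$, minimize $f(x)=\frac1{|\mathcal H|}\sum_{i\in\mathcal H}f_i(x)$ over $\mathbb R^d$, where $f_i(x)=\mathbb E_{\xi\sim\mathcal D_i}[F(x,\xi)]$ with probability measures $\mathcal D_i$ on $\mathbb R^q$ and $F:\mathbb R^d\times\mathbb R^q\to\mathbb R$ Borel. *Function class $\mathcal F_{L,\zeta^2}$*: $f$ is $C^1$; for $i\in\mathcal H$, $f_i$ is bounded below, differentiable and $\nabla f_i$ is $L$-Lipschitz; and $\frac1{|\mathcal H|}\sum_{i\in\mathcal H}\|\nabla f_i(x)-\nabla f(x)\|^2\le\zeta^2$ for all $x$. *Oracle class $\mathcal O_{\sigma^2}$*: $F(\cdot,\xi)$ is $C^1$, the oracle returns $\nabla F(x,\xi)$ (gradient in $x$), and for all $i\in\mathcal H$ and all $x$, $\mathbb E_{\xi\sim\mathcal D_i}[\nabla F(x,\xi)]=\nabla f_i(x)$ and $\mathbb E_{\xi\sim\mathcal D_i}[\|\nabla F(x,\xi)-\nabla f_i(x)\|^2]\le\sigma^2$.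 *Robust aggregator* (for $\rho$, $\delta\in[0,\delta_{\max}]$, $\delta_{\max}<\frac12$, $|\mathcal H|\ge(1-\delta)n$): a measurable map $\mathsf A:(\mathbb R^d)^n\to\mathbb R^d$ with $\|\mathsf A(w_1,\dots,w_n)-\bar w\|^2\le\frac{\rho\delta}{|\mathcal H|}\sum_{i\in\mathcal H}\|w_i-\bar w\|^2$ for all inputs, where $\bar w=\frac1{|\mathcal H|}\sum_{i\in\mathcal H}w_i$. *Method class $\mathcal M$*: starting from $x^0$ with batch size $m\ge1$, in iteration $t=0,1,\dots$ all honest nodes query the oracle at $m$ common points $x^{(t,l)}\in\mathrm{span}(x^0,\dots,x^t)$, with samples $\xi_i^{(t,l)}\sim\mathcal D_i$ that are independent of each other and of the past (this counts as $m$ oracle queries); each honest node $i$ sends $w_i^t=\sum_{j=0}^t\sum_{l=1}^m\alpha_t^{(j,l)}\nabla F(x^{(j,l)},\xi_i^{(j,l)})$, where the coefficients $\alpha_t^{(j,l)}\ge0$ are common to all honest nodes and $\sum_{j,l}\alpha_t^{(j,l)}\ge\alpha_{\min}$ for some constant $\alpha_{\min}>0$; Byzantine nodes send arbitrary vectors;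 the server forms $w^t=\mathsf A(w_1^t,\dots,w_n^t)$ and chooses $x^{t+1}\in\mathrm{span}(x^0,\dots,x^t,w^0,\dots,w^t)$. The output after $t$ iterations is some $\hat x^t\in\mathrm{span}(x^0,\dots,x^t)$. Query points, coefficients, iterates and outputs may be random and may depend on everything that happened in earlier iterations. *Claim.* There are absolute constants $c_0,c>0$ such that for all $n\ge2$, $L,\Delta,\sigma,\rho>0$, $0\le\delta\le\delta_{\max}<\frac12$ and $\varepsilon>0$ with $\varepsilon^2\le c_0L\Delta$, there is a dimension $d$ such that for every $x^0\in\mathbb R^d$ there exist a distributed problem as above with $|\mathcal H|\ge(1-\delta)n$, with $f\in\mathcal F_{L,0}$ (that is, $\zeta^2=0$), with non-convex $f_i$ $(i\in\mathcal H)$, with $f(x^0)-\inf f=\Delta$ and with oracle in $\mathcal O_{\sigma^2}$, and a robust aggregator $\mathsf A$ for $\rho,\delta$, such that every method in $\mathcal M$ started at $x^0$ needs an expected number of oracle queries of at least $$c\,\frac{L\Delta\,\rho\,\delta\,\sigma^2}{\varepsilon^4}$$ to reach a $(0,\varepsilon)$-stationary point: if $\tau$ is a stopping time with values in $\mathbb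 N$ (for instance a fixed number of iterations) and $\mathbb E\|\nabla f(\hat x^{\tau})\|\le\varepsilon$, then $\mathbb E[m\tau]\ge c\,L\Delta\rho\delta\sigma^2/\varepsilon^4$. -/

import Mathlib

open MeasureTheory ProbabilityTheory

/-- `ℝᵏ` with the Euclidean norm. -/
abbrev Vec (k : ℕ) : Type := EuclideanSpace ℝ (Fin k)

/-- A distributed stochastic problem with `n` nodes in dimension `d`:
minimize `f x = (1/|H|) ∑_{i ∈ H} f_i x`, where `f_i x = 𝔼_{ξ ∼ D i} F x ξ`.
The honest nodes are those of `H`, the others are Byzantine and form the minority. -/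
structure DistProblem (n d : ℕ) where
  /-- dimension of the data space -/
  q : ℕ
  /-- the honest nodes -/
  H : Finset (Fin n)
  /-- the local data distributions -/
  D : Fin n → Measure (Vec q)
  /-- the sample loss -/
  F : Vec d → Vec q → ℝ
  honest_majority : Hᶜ.card < H.card
  prob : ∀ i, IsProbabilityMeasure (D i)
  measurable_F : Measurable (Function.uncurry F)
  integrable_F : ∀ i ∈ H, ∀ x, Integrable (F x) (D i)

namespace DistProblem

variable {n d : ℕ}

/-- The local function `f_i x = 𝔼_{ξ ∼ D i} F x ξ`. -/
noncomputable def localLoss (P : DistProblem n d) (i : Fin n) (x : Vec d) : ℝ :=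
  ∫ ξ, P.F x ξ ∂(P.D i)

/-- The global function, the average of the local functions of the honest nodes. -/
noncomputable def loss (P : DistProblem n d) (x : Vec d) : ℝ :=
  (P.H.card : ℝ)⁻¹ * ∑ i ∈ P.H, P.localLoss i x

/-- The stochastic gradient `∇F(x, ξ)` (gradient in `x`) that the oracle returns. -/
noncomputable def stochGrad (P : DistProblem n d) (x : Vec d) (ξ : Vec P.q) : Vec d :=
  gradient (fun z => P.F z ξ) x

/-- The function class: `f` is continuously differentiable, the `f_i` of the honest nodes are
bounded below and `L`-smooth, and the heterogeneity of their gradients is at most `ζsq`. -/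
structure InFunctionClass (P : DistProblem n d) (L ζsq : ℝ) : Prop where
  contDiff_loss : ContDiff ℝ 1 P.loss
  bddBelow : ∀ i ∈ P.H, BddBelow (Set.range (P.localLoss i))
  differentiable : ∀ i ∈ P.H, Differentiable ℝ (P.localLoss i)
  smooth : ∀ i ∈ P.H, ∀ x y,
    ‖gradient (P.localLoss i) x - gradient (P.localLoss i) y‖ ≤ L * ‖x - y‖
  heterogeneity : ∀ x,
    (P.H.card : ℝ)⁻¹ * ∑ i ∈ P.H, ‖gradient (P.localLoss i) x - gradient P.loss x‖ ^ 2 ≤ ζsq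

/-- The oracle class: `F(·, ξ)` is continuously differentiable and its gradient is, for every
honest node, an unbiased estimator of `∇f_i` with variance at most `σsq`.
(The independence of the samples is part of `MethodRun`.) -/
structure InOracleClass (P : DistProblem n d) (σsq : ℝ) : Prop where
  contDiff_F : ∀ ξ, ContDiff ℝ 1 (fun x => P.F x ξ)
  integrable : ∀ i ∈ P.H, ∀ x, Integrable (P.stochGrad x) (P.D i)
  unbiased : ∀ i ∈ P.H, ∀ x, ∫ ξ, P.stochGrad x ξ ∂(P.D i) = gradient (P.localLoss i) x
  variance : ∀ i ∈ P.H, ∀ x,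
    ∫⁻ ξ, ‖P.stochGrad x ξ - gradient (P.localLoss i) x‖ₑ ^ 2 ∂(P.D i) ≤ ENNReal.ofReal σsq

end DistProblem

/-- The average of the inputs of the honest nodes. -/
noncomputable def honestMean {n d : ℕ} (H : Finset (Fin n)) (w : Fin n → Vec d) : Vec d :=
  (H.card : ℝ)⁻¹ • ∑ i ∈ H, w i

/-- `A` is a robust aggregator with coefficient `ρ`, for the honest set `H` and the estimated
fraction `δ` of Byzantine nodes: whatever the inputs of all nodes are,
`‖A w - w̄‖² ≤ (ρ δ / |H|) ∑_{i ∈ H} ‖w_i - w̄‖²`, where `w̄` is the honest average. -/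
structure IsRobustAggregator {n d : ℕ} (ρ δ : ℝ) (H : Finset (Fin n))
    (A : (Fin n → Vec d) → Vec d) : Prop where
  measurable : Measurable A
  card_honest : (1 - δ) * n ≤ H.card
  robust : ∀ w : Fin n → Vec d,
    ‖A w - honestMean H w‖ ^ 2 ≤ ρ * δ / H.card * ∑ i ∈ H, ‖w i - honestMean H w‖ ^ 2

/-- An execution, on the probability space `(Ω, μ)`, of a method of the class considered, applied
to the problem `P` with the aggregator `A` from the initial point `x₀`.
`𝓖 t` is the information that is available when iteration `t` starts (it contains the internal
randomness of the method). In iteration `t` every honest node evaluates its oracle at the same `m`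
points (this counts as `m` oracle queries), and sends a nonnegative combination of the stochastic
gradients that it has obtained so far, with coefficients that are common to all honest nodes;
Byzantine nodes send anything. The server aggregates and moves within the span of the past
iterates and aggregated vectors. -/
structure MethodRun {n d : ℕ} (P : DistProblem n d) (A : (Fin n → Vec d) → Vec d) (x₀ : Vec d)
    {Ω : Type*} [mΩ : MeasurableSpace Ω] (μ : Measure Ω) where
  /-- batch size -/
  m : ℕ
  m_pos : 0 < m
  /-- information available at the start of each iteration -/
  𝓖 : Filtration ℕ mΩ
  /-- iterates `x^t` -/
  x : ℕ → Ω → Vec d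
  /-- query points `x^(t,l)` -/
  y : ℕ → Fin m → Ω → Vec d
  /-- samples `ξ_i^(t,l)` -/
  ξ : ℕ → Fin n → Fin m → Ω → Vec P.q
  /-- `α t j l` is the coefficient, in iteration `t`, of the `l`-th stochastic gradient
  of iteration `j` -/
  α : ℕ → ℕ → Fin m → Ω → ℝ
  /-- lower bound for the total weight -/
  αmin : ℝ
  /-- messages `w_i^t` of the nodes -/
  v : ℕ → Fin n → Ω → Vec d
  /-- aggregated vectors `w^t` -/
  w : ℕ → Ω → Vec d
  /-- outputs after `t` iterations -/
  out : ℕ → Ω → Vec d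
  measurable_x : ∀ t, Measurable[𝓖 t] (x t)
  measurable_y : ∀ t l, Measurable[𝓖 t] (y t l)
  measurable_α : ∀ t j l, Measurable[𝓖 t] (α t j l)
  measurable_out : ∀ t, Measurable[𝓖 t] (out t)
  measurable_ξ : ∀ t i l, Measurable[𝓖 (t + 1)] (ξ t i l)
  measurable_v : ∀ t i, Measurable[𝓖 (t + 1)] (v t i)
  /-- within an iteration the samples of the honest nodes are independent with laws `D i` -/
  law_ξ : ∀ t, μ.map (fun ω (p : P.H × Fin m) => ξ t p.1 p.2 ω)
    = Measure.pi (fun p : P.H × Fin m => P.D p.1)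
  /-- the samples of an iteration are independent of everything that happened before -/
  indep_ξ : ∀ t, Indep
    (MeasurableSpace.comap (fun ω (p : P.H × Fin m) => ξ t p.1 p.2 ω) inferInstance) (𝓖 t) μ
  init : ∀ ω, x 0 ω = x₀
  query_mem : ∀ t l ω, y t l ω ∈ Submodule.span ℝ {z | ∃ s ≤ t, z = x s ω}
  α_nonneg : ∀ t j l ω, 0 ≤ α t j l ω
  αmin_pos : 0 < αmin
  αmin_le : ∀ t ω, αmin ≤ ∑ j ∈ Finset.range (t + 1), ∑ l, α t j l ω
  honest_msg : ∀ t, ∀ i ∈ P.H, ∀ ω,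
    v t i ω = ∑ j ∈ Finset.range (t + 1), ∑ l, α t j l ω • P.stochGrad (y j l ω) (ξ j i l ω)
  aggregate : ∀ t ω, w t ω = A (fun i => v t i ω)
  update_mem : ∀ t ω,
    x (t + 1) ω ∈ Submodule.span ℝ {z | ∃ s ≤ t, z = x s ω ∨ z = w s ω}
  out_mem : ∀ t ω, out t ω ∈ Submodule.span ℝ {z | ∃ s ≤ t, z = x s ω}

/-! The hard function is a chain of length `T`: in a rotated basis whose axis `0` carries `x₀`, its
gradient at a point supported on coordinates `≤ k` involves no coordinate beyond `k + 1`, and its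
norm is at least `1/4` as long as coordinate `T` vanishes (`quarter_le_norm_chainPartial`). After
rescaling to gradient size `8ε`, an output without coordinate `T` has gradient norm at least `2ε`. A
method confined to spans must therefore reveal the coordinates one at a time, and smoothness and the
gap `Δ` allow `T` of order `LΔ/ε²`.

The noise makes each coordinate expensive. The sample loss is `chain + (ξ - 1) * chainNoise`,
rescaled; the two gradients agree in the frontier coordinate `k + 1`, so the oracle returns `ξ`
times its true value there. The factor `ξ` has mean `1`; with probability `1 - p` it takes a typical
value at distance `η` from `1`, otherwise a compensating rare one. The noise must be the gradient of
a potential, and `norm_ofSeq_chainNoisePartial_sq_le` bounds this gradient independently of the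
dimension, so `p` of order `η²ε²/σ²` is compatible with variance `σ²`.

The aggregator does the damage: coordinatewise it returns `0` instead of the honest mean whenever an
error budget of `K = ρδ` times the empirical variance permits. Query points and coefficients are
common to the honest nodes, so a node with only typical samples sends `good i * S` in the frontier
coordinate, with the same `S` for all. By `exists_typical_factors` such a mean is hidden until a
fraction `θ ≥ Kη²/36` of the honest nodes has drawn a rare sample.

Samples drawn before a level was reached do not affect the next coordinate, so every level requires
fresh rare samples, and coordinate `T` requires at least `θ|H|T` of them (`exists_level`). By Wald's
inequality their expected number is at most `p|H| 𝔼[mτ]`. Expected gradient norm at most `ε` forces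
coordinate `T` to be reached with probability at least `1/2`, whence `𝔼[mτ] ≥ θT/(2p)`
(`le_lintegral_queries`), which has the claimed order. -/

/-! ### Scalar building blocks -/

/-- The even function `1 - exp (-u²)`, which vanishes to second order at `0`. -/
noncomputable def bump (u : ℝ) : ℝ := 1 - Real.exp (-u ^ 2)

/-- The derivative of `bump`. -/
noncomputable def bumpDeriv (u : ℝ) : ℝ := 2 * u * Real.exp (-u ^ 2)

/-- The odd function with derivative `|bumpDeriv|`. -/
noncomputable def oddBump (u : ℝ) : ℝ := if 0 ≤ u then bump u else -bump u

lemma bump_zero : bump 0 = 0 := by simp [bump]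

lemma bumpDeriv_zero : bumpDeriv 0 = 0 := by simp [bumpDeriv]

lemma bump_nonneg (u : ℝ) : 0 ≤ bump u := by
  have : Real.exp (-u ^ 2) ≤ 1 := Real.exp_le_one_iff.2 (by nlinarith [sq_nonneg u])
  unfold bump; linarith

lemma bump_le_one (u : ℝ) : bump u ≤ 1 := by
  have := Real.exp_pos (-u ^ 2)
  unfold bump; linarith

lemma hasDerivAt_exp_neg_sq (u : ℝ) :
    HasDerivAt (fun u : ℝ => Real.exp (-u ^ 2)) (-(2 * u) * Real.exp (-u ^ 2)) u := by
  have h : HasDerivAt (fun u : ℝ => -u ^ 2) (-(2 * u)) u := by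
    exact (hasDerivAt_pow 2 u).neg.congr_deriv (by simp)
  exact h.exp.congr_deriv (by ring)

lemma hasDerivAt_bump (u : ℝ) : HasDerivAt bump (bumpDeriv u) u := by
  exact ((hasDerivAt_exp_neg_sq u).const_sub 1).congr_deriv (by unfold bumpDeriv; ring)

lemma continuous_bump : Continuous bump := by unfold bump; fun_prop

lemma continuous_bumpDeriv : Continuous bumpDeriv := by unfold bumpDeriv; fun_prop

lemma continuous_oddBump : Continuous oddBump := by
  refine continuous_if_le continuous_const continuous_id continuous_bump.continuousOn
    continuous_bump.neg.continuousOn ?_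
  intro u hu
  subst hu
  simp [bump_zero]

lemma hasDerivAt_oddBump (u : ℝ) : HasDerivAt oddBump |bumpDeriv u| u := by
  have hne : ∀ v : ℝ, v ≠ 0 → HasDerivAt oddBump |bumpDeriv v| v := by
    intro v hv
    rcases lt_or_gt_of_ne hv with h | h
    · have h1 : |bumpDeriv v| = -bumpDeriv v := abs_of_nonpos (by
        unfold bumpDeriv; nlinarith [Real.exp_pos (-v ^ 2)])
      rw [h1]
      refine (hasDerivAt_bump v).neg.congr_of_eventuallyEq ?_
      filter_upwards [Iio_mem_nhds h] with w hw
      simp [oddBump, not_le.2 (Set.mem_Iio.1 hw)]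
    · have h1 : |bumpDeriv v| = bumpDeriv v := abs_of_nonneg (by
        unfold bumpDeriv; positivity)
      rw [h1]
      refine (hasDerivAt_bump v).congr_of_eventuallyEq ?_
      filter_upwards [Ioi_mem_nhds h] with w hw
      simp [oddBump, le_of_lt (Set.mem_Ioi.1 hw)]
  by_cases hu : u = 0
  -- At the corner, differentiability follows from the limit of the derivatives at nonzero points.
  · subst hu
    exact hasDerivAt_of_hasDerivAt_of_ne (fun y hy => hne y hy) continuous_oddBump.continuousAt
      continuous_bumpDeriv.abs.continuousAt
  · exact hne u hu

lemma abs_oddBump_le_one (u : ℝ) : |oddBump u| ≤ 1 := by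
  have h0 := bump_nonneg u
  have h1 := bump_le_one u
  unfold oddBump
  split_ifs <;> rw [abs_le] <;> constructor <;> linarith

lemma two_abs_mul_exp_le_one (u : ℝ) : 2 * |u| * Real.exp (-u ^ 2) ≤ 1 := by
  have h1 : 1 + u ^ 2 ≤ Real.exp (u ^ 2) := by linarith [Real.add_one_le_exp (u ^ 2)]
  rw [Real.exp_neg, ← div_eq_mul_inv, div_le_one (Real.exp_pos _)]
  nlinarith [sq_nonneg (|u| - 1), sq_abs u]

lemma abs_bumpDeriv_le_one (u : ℝ) : |bumpDeriv u| ≤ 1 := by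
  unfold bumpDeriv
  rw [abs_mul, abs_mul, abs_of_pos (Real.exp_pos _), abs_two]
  exact two_abs_mul_exp_le_one u

/-- Equivalent to `1 + u² ≤ exp (u²)`. It later turns squared noise terms into increments of
`decay`, which telescope. -/
lemma sq_mul_exp_le_bump (u : ℝ) : u ^ 2 * Real.exp (-u ^ 2) ≤ bump u := by
  have h1 : 1 + u ^ 2 ≤ Real.exp (u ^ 2) := by linarith [Real.add_one_le_exp (u ^ 2)]
  have h2 : Real.exp (u ^ 2) * Real.exp (-u ^ 2) = 1 := by rw [← Real.exp_add]; simp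
  unfold bump
  nlinarith [Real.exp_pos (-u ^ 2)]

lemma bumpDeriv_sq_le (u : ℝ) : bumpDeriv u ^ 2 ≤ 4 * bump u := by
  have h1 := sq_mul_exp_le_bump u
  have h2 : Real.exp (-u ^ 2) ≤ 1 := Real.exp_le_one_iff.2 (by nlinarith [sq_nonneg u])
  have h3 := Real.exp_pos (-u ^ 2)
  have h4 : bumpDeriv u ^ 2 = 4 * (u ^ 2 * Real.exp (-u ^ 2)) * Real.exp (-u ^ 2) := by
    unfold bumpDeriv; ring
  rw [h4]
  have : 0 ≤ 4 * (u ^ 2 * Real.exp (-u ^ 2)) := by positivity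
  nlinarith

/-- A differentiable real function whose derivative is bounded by `C` is `C`-Lipschitz. -/
lemma abs_sub_le_of_hasDerivAt {f f' : ℝ → ℝ} {C : ℝ} (hf : ∀ x, HasDerivAt f (f' x) x)
    (hC : ∀ x, |f' x| ≤ C) (x y : ℝ) : |f x - f y| ≤ C * |x - y| := by
  simpa [Real.norm_eq_abs] using convex_univ.norm_image_sub_le_of_norm_hasDerivWithin_le
    (fun z _ => (hf z).hasDerivWithinAt) (fun z _ => hC z) (Set.mem_univ y) (Set.mem_univ x)

lemma abs_bump_sub_le (x y : ℝ) : |bump x - bump y| ≤ |x - y| := by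
  simpa using abs_sub_le_of_hasDerivAt hasDerivAt_bump abs_bumpDeriv_le_one x y

lemma abs_bumpDeriv_sub_le (x y : ℝ) : |bumpDeriv x - bumpDeriv y| ≤ 2 * |x - y| := by
  refine abs_sub_le_of_hasDerivAt (f' := fun u => (2 - 4 * u ^ 2) * Real.exp (-u ^ 2))
    (fun u => ?_) (fun u => ?_) x y
  · exact (((hasDerivAt_id u).const_mul 2).mul (hasDerivAt_exp_neg_sq u)).congr_deriv
      (by simp; ring)
  -- The claim is `|2 - 4u²| ≤ 2 exp (u²)`; the bound `1 + u² ≤ exp (u²)` is too weak for large `u`.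
  · have h := Real.quadratic_le_exp_of_nonneg (sq_nonneg u)
    rw [abs_mul, abs_of_pos (Real.exp_pos _), Real.exp_neg, ← div_eq_mul_inv,
      div_le_iff₀ (Real.exp_pos _), abs_le]
    constructor <;> nlinarith [sq_nonneg (u ^ 2 - 1), sq_nonneg u]

lemma abs_arctan_sub_le (x y : ℝ) : |Real.arctan x - Real.arctan y| ≤ |x - y| := by
  have h := abs_sub_le_of_hasDerivAt (C := 1) Real.hasDerivAt_arctan (fun u => ?_) x y
  · simpa using h
  · rw [abs_of_nonneg (by positivity)]
    rw [div_le_one (by positivity)]; nlinarith [sq_nonneg u]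

lemma abs_arctan_le_two (x : ℝ) : |Real.arctan x| ≤ 2 := by
  rw [abs_le]
  constructor <;> linarith [Real.arctan_lt_pi_div_two x, Real.neg_pi_div_two_lt_arctan x,
    Real.pi_lt_four]

/-- The derivative of `Real.arctan`. -/
noncomputable def arctanDeriv (u : ℝ) : ℝ := 1 / (1 + u ^ 2)

lemma arctanDeriv_nonneg (u : ℝ) : 0 ≤ arctanDeriv u := by unfold arctanDeriv; positivity

lemma arctanDeriv_le_one (u : ℝ) : arctanDeriv u ≤ 1 := by
  unfold arctanDeriv
  rw [div_le_one (by positivity)]; nlinarith [sq_nonneg u]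

lemma abs_arctanDeriv_sub_le (x y : ℝ) : |arctanDeriv x - arctanDeriv y| ≤ |x - y| := by
  have h := abs_sub_le_of_hasDerivAt (C := 1) (f := arctanDeriv)
    (f' := fun u => -(2 * u) / (1 + u ^ 2) ^ 2) (fun u => ?_) (fun u => ?_) x y
  · simpa using h
  · have h1 : HasDerivAt (fun u : ℝ => 1 + u ^ 2) (2 * u) u := by
      simpa using (hasDerivAt_pow 2 u).const_add 1
    have h2 := h1.inv (by positivity)
    refine h2.congr_of_eventuallyEq (Filter.Eventually.of_forall fun v => ?_)
    simp [arctanDeriv]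
  · rw [abs_div, abs_of_pos (a := (1 + u ^ 2) ^ 2) (by positivity), div_le_one (by positivity),
      abs_le]
    constructor <;> nlinarith [sq_nonneg (u ^ 2), sq_nonneg u, sq_nonneg (u - 1),
      sq_nonneg (u + 1)]

/-- The factor with which a coordinate enables the next one; coordinate `0` is always enabling. -/
noncomputable def chainWeight : ℕ → ℝ → ℝ
  | 0 => fun _ => 1
  | _ + 1 => bump

/-- The derivative of `chainWeight`. -/
noncomputable def chainWeightDeriv : ℕ → ℝ → ℝ
  | 0 => fun _ => 0
  | _ + 1 => bumpDeriv

lemma hasDerivAt_chainWeight (j : ℕ) (u : ℝ) :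
    HasDerivAt (chainWeight j) (chainWeightDeriv j u) u := by
  cases j with
  | zero => exact hasDerivAt_const u 1
  | succ j => exact hasDerivAt_bump u

lemma chainWeight_nonneg (j : ℕ) (u : ℝ) : 0 ≤ chainWeight j u := by
  cases j with
  | zero => exact zero_le_one
  | succ j => exact bump_nonneg u

lemma chainWeight_le_one (j : ℕ) (u : ℝ) : chainWeight j u ≤ 1 := by
  cases j with
  | zero => exact le_rfl
  | succ j => exact bump_le_one u

lemma abs_chainWeight_sub_le (j : ℕ) (x y : ℝ) :
    |chainWeight j x - chainWeight j y| ≤ |x - y| := by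
  cases j with
  | zero => simp [chainWeight]
  | succ j => exact abs_bump_sub_le x y

lemma contDiff_bump : ContDiff ℝ 1 bump := by unfold bump; fun_prop

lemma contDiff_chainWeight (j : ℕ) : ContDiff ℝ 1 (chainWeight j) := by
  cases j with
  | zero => exact contDiff_const
  | succ j => exact contDiff_bump

lemma contDiff_oddBump : ContDiff ℝ 1 oddBump := by
  rw [contDiff_one_iff_deriv]
  refine ⟨fun u => (hasDerivAt_oddBump u).differentiableAt, ?_⟩
  have : deriv oddBump = fun u => |bumpDeriv u| := funext fun u => (hasDerivAt_oddBump u).deriv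
  rw [this]
  exact continuous_bumpDeriv.abs

/-! ### Coordinates indexed by natural numbers -/

/-- The `j`-th coordinate, which is `0` for `j ≥ d`. -/
noncomputable def coord {d : ℕ} (j : ℕ) : Vec d →L[ℝ] ℝ :=
  if h : j < d then EuclideanSpace.proj ⟨j, h⟩ else 0

/-- The vector whose coordinates are the first `d` terms of a sequence. -/
noncomputable def ofSeq (d : ℕ) (c : ℕ → ℝ) : Vec d := WithLp.toLp 2 fun j => c j

lemma coord_fin {d : ℕ} (x : Vec d) (j : Fin d) : coord (j : ℕ) x = x j := by
  simp [coord]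

lemma coord_of_lt {d j : ℕ} (h : j < d) (x : Vec d) : coord j x = x ⟨j, h⟩ := by
  simp [coord, h]

lemma coord_of_le {d j : ℕ} (h : d ≤ j) (x : Vec d) : coord j x = 0 := by
  simp [coord, not_lt.2 h]

lemma coord_ofSeq {d j : ℕ} (h : j < d) (c : ℕ → ℝ) : coord j (ofSeq d c) = c j := by
  rw [coord_of_lt h]; rfl

lemma norm_sq_eq_sum_coord {d : ℕ} (x : Vec d) :
    ‖x‖ ^ 2 = ∑ j ∈ Finset.range d, coord j x ^ 2 := by
  rw [EuclideanSpace.real_norm_sq_eq, ← Fin.sum_univ_eq_sum_range (fun j => coord j x ^ 2)]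
  simp [coord_fin]

lemma norm_ofSeq_sq {d : ℕ} (c : ℕ → ℝ) :
    ‖ofSeq d c‖ ^ 2 = ∑ j ∈ Finset.range d, c j ^ 2 := by
  rw [norm_sq_eq_sum_coord]
  exact Finset.sum_congr rfl fun j hj => by rw [coord_ofSeq (Finset.mem_range.1 hj)]

lemma hasGradientAt_ofSeq {d : ℕ} {f : Vec d → ℝ} {c : ℕ → ℝ} {x : Vec d}
    (h : HasFDerivAt f (∑ j ∈ Finset.range d, c j • (coord j : Vec d →L[ℝ] ℝ)) x) :
    HasGradientAt f (ofSeq d c) x := by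
  rw [hasGradientAt_iff_hasFDerivAt]
  refine h.congr_fderiv (ContinuousLinearMap.ext fun v => ?_)
  symm
  rw [InnerProductSpace.toDual_apply_apply, PiLp.inner_apply, sum_apply,
    ← Fin.sum_univ_eq_sum_range (fun j => (c j • (coord j : Vec d →L[ℝ] ℝ)) v)]
  refine Finset.sum_congr rfl fun j _ => ?_
  simp [coord_fin, ofSeq, mul_comm]

/-! ### The chain function -/

/-- A bounded smooth function with large gradient wherever the last coordinate vanishes, whose
gradient involves at most one more coordinate than its argument. -/
noncomputable def chain (T : ℕ) (x : Vec (T + 1)) : ℝ :=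
  -∑ j ∈ Finset.range T, (2 * oddBump (coord (j + 1) x)
    + chainWeight j (coord j x) * Real.arctan (coord (j + 1) x))

/-- The partial derivatives of `chain`. -/
noncomputable def chainPartial {d : ℕ} (x : Vec d) : ℕ → ℝ
  | 0 => 0
  | j + 1 => -(2 * |bumpDeriv (coord (j + 1) x)|
      + bumpDeriv (coord (j + 1) x) * Real.arctan (coord (j + 2) x)
      + chainWeight j (coord j x) * arctanDeriv (coord (j + 1) x))

lemma HasDerivAt.comp_coord {f : ℝ → ℝ} {f' : ℝ} {d : ℕ} (j : ℕ) {x : Vec d}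
    (h : HasDerivAt f f' (coord j x)) :
    HasFDerivAt (fun z : Vec d => f (coord j z)) (f' • (coord j : Vec d →L[ℝ] ℝ)) x :=
  h.comp_hasFDerivAt x (coord j).hasFDerivAt

/-- Shift of a sum whose first and last terms vanish. -/
lemma sum_range_eq_sum_range_succ_of_eq_zero {M : Type*} [AddCommMonoid M] {T : ℕ} {B : ℕ → M}
    (h0 : B 0 = 0) (hT : B T = 0) :
    ∑ j ∈ Finset.range T, B j = ∑ j ∈ Finset.range T, B (j + 1) := by
  have h1 := Finset.sum_range_succ B T
  have h2 := Finset.sum_range_succ' B T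
  rw [hT, add_zero] at h1
  rw [h0, add_zero] at h2
  rw [← h1, h2]

lemma hasFDerivAt_chain (T : ℕ) (x : Vec (T + 1)) :
    HasFDerivAt (chain T)
      (∑ j ∈ Finset.range (T + 1), chainPartial x j • (coord j : Vec (T + 1) →L[ℝ] ℝ)) x := by
  have hterm : ∀ j ∈ Finset.range T, HasFDerivAt (fun z : Vec (T + 1) =>
      2 * oddBump (coord (j + 1) z)
        + chainWeight j (coord j z) * Real.arctan (coord (j + 1) z)) _ x := fun j _ =>
    (((hasDerivAt_oddBump _).comp_coord (j + 1)).const_mul 2).add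
      (((hasDerivAt_chainWeight j _).comp_coord j).mul
        ((Real.hasDerivAt_arctan _).comp_coord (j + 1)))
  refine ((HasFDerivAt.fun_sum hterm).neg).congr_fderiv ?_
  refine ContinuousLinearMap.ext fun v => ?_
  -- Term `j` also depends on coordinate `j` through its weight. Shifting the index collects
  -- everything at coordinate `j + 1`; the boundary terms vanish because weight `0` is constant and
  -- coordinate `T + 1` is `0` by convention.
  have hshift := sum_range_eq_sum_range_succ_of_eq_zero (T := T)
    (B := fun j => Real.arctan (coord (j + 1) x) * (chainWeightDeriv j (coord j x) * coord j v))
    (by simp [chainWeightDeriv]) (by simp [coord_of_le])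
  rw [Finset.sum_range_succ']
  simp only [sum_apply, neg_apply, add_apply, smul_apply, smul_eq_mul, Finset.sum_add_distrib,
    chainPartial, hshift, zero_mul, add_zero]
  rw [← Finset.sum_add_distrib, ← Finset.sum_add_distrib, ← Finset.sum_neg_distrib]
  refine Finset.sum_congr rfl fun j _ => ?_
  simp only [chainWeightDeriv, arctanDeriv]
  ring

lemma hasGradientAt_chain (T : ℕ) (x : Vec (T + 1)) :
    HasGradientAt (chain T) (ofSeq (T + 1) (chainPartial x)) x :=
  hasGradientAt_ofSeq (hasFDerivAt_chain T x)

lemma contDiff_chain (T : ℕ) : ContDiff ℝ 1 (chain T) := by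
  unfold chain
  refine ContDiff.neg (ContDiff.sum fun j _ => ContDiff.add ?_ (ContDiff.mul ?_ ?_))
  · exact contDiff_const.mul (contDiff_oddBump.comp (coord (j + 1)).contDiff)
  · exact (contDiff_chainWeight j).comp (coord j).contDiff
  · exact Real.contDiff_arctan.comp (coord (j + 1)).contDiff

lemma abs_chain_le (T : ℕ) (x : Vec (T + 1)) : |chain T x| ≤ 4 * T := by
  unfold chain
  rw [abs_neg]
  refine (Finset.abs_sum_le_sum_abs _ _).trans ?_
  calc _ ≤ ∑ j ∈ Finset.range T, (4 : ℝ) := by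
        refine Finset.sum_le_sum fun j _ => (abs_add_le _ _).trans ?_
        rw [abs_mul, abs_mul, abs_two, abs_of_nonneg (chainWeight_nonneg _ _)]
        have h1 := abs_oddBump_le_one (coord (j + 1) x)
        have h2 := mul_le_mul (chainWeight_le_one j (coord j x))
          (abs_arctan_le_two (coord (j + 1) x)) (abs_nonneg _) zero_le_one
        linarith
    _ = 4 * T := by simp [mul_comm]

lemma chain_eq_zero {T : ℕ} {x : Vec (T + 1)} (hx : ∀ j, 0 < j → coord j x = 0) :
    chain T x = 0 := by
  unfold chain
  rw [Finset.sum_eq_zero, neg_zero]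
  intro j _
  simp [hx (j + 1) j.succ_pos, oddBump, bump_zero]

lemma exists_chain_neg {T : ℕ} (hT : 0 < T) : ∃ x, chain T x < 0 := by
  refine ⟨ofSeq (T + 1) fun _ => 1, ?_⟩
  unfold chain
  rw [neg_lt_zero]
  refine Finset.sum_pos (fun j hj => ?_) ⟨0, Finset.mem_range.2 hT⟩
  have hj := Finset.mem_range.1 hj
  rw [coord_ofSeq (by omega), coord_ofSeq (by omega), Real.arctan_one]
  have h1 : 0 < oddBump 1 := by
    simp [oddBump, bump]
  have := mul_nonneg (chainWeight_nonneg j 1) (by positivity : 0 ≤ Real.pi / 4)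
  linarith

/-- The coefficient `9` is `4` from `2 * |bumpDeriv|`, `4` from `bumpDeriv` times `arctan ≤ 2`, and
`1` from `arctanDeriv`. -/
lemma abs_chainPartial_sub_le {d : ℕ} (x y : Vec d) (j : ℕ) :
    |chainPartial x (j + 1) - chainPartial y (j + 1)| ≤
      9 * |coord (j + 1) x - coord (j + 1) y| + |coord (j + 2) x - coord (j + 2) y|
        + |coord j x - coord j y| := by
  have hmul : ∀ a b a' b' A B : ℝ, |a| ≤ A → |b'| ≤ B →
      |a * b - a' * b'| ≤ A * |b - b'| + B * |a - a'| := by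
    intro a b a' b' A B hA hB
    have : a * b - a' * b' = a * (b - b') + b' * (a - a') := by ring
    rw [this]
    refine (abs_add_le _ _).trans ?_
    rw [abs_mul, abs_mul]
    gcongr
  have h1 : |(|bumpDeriv (coord (j + 1) x)| - |bumpDeriv (coord (j + 1) y)|)|
      ≤ 2 * |coord (j + 1) x - coord (j + 1) y| :=
    (abs_abs_sub_abs_le _ _).trans (abs_bumpDeriv_sub_le _ _)
  have h2 := hmul _ (Real.arctan (coord (j + 2) x)) (bumpDeriv (coord (j + 1) y)) _ _ _
    (abs_bumpDeriv_le_one (coord (j + 1) x)) (abs_arctan_le_two (coord (j + 2) y))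
  have h3 := hmul (chainWeight j (coord j x)) (arctanDeriv (coord (j + 1) x))
    (chainWeight j (coord j y)) (arctanDeriv (coord (j + 1) y)) 1 1
    (by rw [abs_of_nonneg (chainWeight_nonneg _ _)]; exact chainWeight_le_one _ _)
    (by rw [abs_of_nonneg (arctanDeriv_nonneg _)]; exact arctanDeriv_le_one _)
  have h4 := abs_bumpDeriv_sub_le (coord (j + 1) x) (coord (j + 1) y)
  have h5 := abs_arctan_sub_le (coord (j + 2) x) (coord (j + 2) y)
  have h6 := abs_arctanDeriv_sub_le (coord (j + 1) x) (coord (j + 1) y)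
  have h7 := abs_chainWeight_sub_le j (coord j x) (coord j y)
  simp only [chainPartial]
  rw [abs_le] at h1 h2 h3 ⊢
  constructor <;> linarith [h1.1, h1.2, h2.1, h2.2, h3.1, h3.2]

/-- The dependence is tridiagonal with coefficients `9, 1, 1`. Weighted Cauchy–Schwarz gives `(9a +
b + c)² ≤ 11 (9a² + b² + c²)`, and summation gives `11²`, independently of `T`. -/
lemma norm_ofSeq_chainPartial_sub_le (T : ℕ) (x y : Vec (T + 1)) :
    ‖ofSeq (T + 1) (chainPartial x) - ofSeq (T + 1) (chainPartial y)‖ ≤ 11 * ‖x - y‖ := by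
  have hsub : ofSeq (T + 1) (chainPartial x) - ofSeq (T + 1) (chainPartial y)
      = ofSeq (T + 1) (fun j => chainPartial x j - chainPartial y j) := by
    ext j; simp [ofSeq]
  refine (sq_le_sq₀ (norm_nonneg _) (by positivity)).1 ?_
  rw [hsub, norm_ofSeq_sq, mul_pow, norm_sq_eq_sum_coord, Finset.sum_range_succ']
  set δ : ℕ → ℝ := fun j => coord j (x - y) with hδ
  have hδT : δ (T + 1) = 0 := coord_of_le le_rfl _
  have hb : ∀ j, (chainPartial x (j + 1) - chainPartial y (j + 1)) ^ 2
      ≤ 11 * (9 * δ (j + 1) ^ 2 + δ (j + 2) ^ 2 + δ j ^ 2) := by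
    intro j
    have h := abs_chainPartial_sub_le x y j
    rw [← sq_abs (chainPartial x (j + 1) - chainPartial y (j + 1)), ← sq_abs (δ (j + 1)),
      ← sq_abs (δ (j + 2)), ← sq_abs (δ j)]
    simp only [hδ, map_sub]
    refine (pow_le_pow_left₀ (abs_nonneg _) h 2).trans ?_
    generalize |coord (j + 1) x - coord (j + 1) y| = a
    generalize |coord (j + 2) x - coord (j + 2) y| = b
    generalize |coord j x - coord j y| = c
    nlinarith [sq_nonneg (a - b), sq_nonneg (a - c), sq_nonneg (b - c)]
  have hs0 : ∑ j ∈ Finset.range T, δ j ^ 2 ≤ ∑ j ∈ Finset.range (T + 1), δ j ^ 2 :=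
    Finset.sum_le_sum_of_subset_of_nonneg (Finset.range_mono (Nat.le_succ _))
      fun _ _ _ => sq_nonneg _
  have hs1 : ∑ j ∈ Finset.range T, δ (j + 1) ^ 2 ≤ ∑ j ∈ Finset.range (T + 1), δ j ^ 2 := by
    rw [Finset.sum_range_succ']
    exact le_add_of_nonneg_right (sq_nonneg _)
  have hs2 : ∑ j ∈ Finset.range T, δ (j + 2) ^ 2 ≤ ∑ j ∈ Finset.range (T + 1), δ j ^ 2 := by
    have h1 := Finset.sum_range_succ' (fun j => δ (j + 1) ^ 2) T
    have h2 := Finset.sum_range_succ (fun j => δ (j + 1) ^ 2) T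
    simp only [hδT] at h2
    nlinarith [sq_nonneg (δ (0 + 1))]
  calc _ ≤ ∑ j ∈ Finset.range T, 11 * (9 * δ (j + 1) ^ 2 + δ (j + 2) ^ 2 + δ j ^ 2) + 0 := by
        refine add_le_add (Finset.sum_le_sum fun j _ => hb j) (by simp [chainPartial])
    _ ≤ 11 ^ 2 * ∑ j ∈ Finset.range (T + 1), δ j ^ 2 := by
        rw [← Finset.mul_sum, Finset.sum_add_distrib, Finset.sum_add_distrib, ← Finset.mul_sum]
        linarith

/-- The term `2 * |bumpDeriv|` coming from `oddBump` absorbs the only term of unknown sign, since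
`|arctan| ≤ 2`. Hence nothing can cancel the enabling term. -/
lemma chainPartial_le_neg {d : ℕ} (x : Vec d) (j : ℕ) :
    chainPartial x (j + 1) ≤ -(chainWeight j (coord j x) * arctanDeriv (coord (j + 1) x)) := by
  have h := abs_arctan_le_two (coord (j + 2) x)
  have h1 : |bumpDeriv (coord (j + 1) x) * Real.arctan (coord (j + 2) x)|
      ≤ |bumpDeriv (coord (j + 1) x)| * 2 := by
    rw [abs_mul]; gcongr
  simp only [chainPartial]
  linarith [(abs_le.1 h1).1]

lemma quarter_le_norm_chainPartial {T : ℕ} (hT : 0 < T) {x : Vec (T + 1)} (hx : coord T x = 0) :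
    1 / 4 ≤ ‖ofSeq (T + 1) (chainPartial x)‖ := by
  -- At the first positive index with a coordinate below `1` in absolute value, the previous weight
  -- and `arctanDeriv` are both at least `1/2`.
  have hex : ∃ j, 0 < j ∧ |coord j x| < 1 := ⟨T, hT, by simp [hx]⟩
  classical
  obtain ⟨hpos, hlt⟩ := Nat.find_spec hex
  have hleT : Nat.find hex ≤ T := Nat.find_min' hex ⟨hT, by simp [hx]⟩
  have hmin : ∀ i, 0 < i → i < Nat.find hex → 1 ≤ |coord i x| := fun i hi hlt => by
    have := Nat.find_min hex hlt
    simp only [not_and, not_lt] at this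
    exact this hi
  generalize Nat.find hex = k at *
  obtain ⟨j, rfl⟩ : ∃ j, k = j + 1 := ⟨k - 1, by omega⟩
  have hw : 1 / 2 ≤ chainWeight j (coord j x) := by
    cases j with
    | zero => norm_num [chainWeight]
    | succ j =>
      have h1 := hmin (j + 1) (by omega) (by omega)
      have h2 : 1 ≤ coord (j + 1) x ^ 2 := by
        rw [← sq_abs]; nlinarith
      have h3 : Real.exp (-coord (j + 1) x ^ 2) ≤ 1 / 2 := by
        rw [Real.exp_neg, inv_le_comm₀ (Real.exp_pos _) (by norm_num)]
        linarith [Real.add_one_le_exp (coord (j + 1) x ^ 2)]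
      simp only [chainWeight, bump]
      linarith
  have ha : 1 / 2 ≤ arctanDeriv (coord (j + 1) x) := by
    unfold arctanDeriv
    rw [div_le_div_iff₀ (by norm_num) (by positivity)]
    have : coord (j + 1) x ^ 2 ≤ 1 := by
      rw [← sq_abs]; nlinarith [abs_nonneg (coord (j + 1) x)]
    linarith
  have hle := chainPartial_le_neg x j
  have hprod : (1 / 2 : ℝ) * (1 / 2) ≤ chainWeight j (coord j x) * arctanDeriv (coord (j + 1) x) :=
    mul_le_mul hw ha (by norm_num) (by linarith)
  refine (sq_le_sq₀ (by norm_num) (norm_nonneg _)).1 ?_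
  rw [norm_ofSeq_sq]
  refine le_trans ?_ (Finset.single_le_sum (f := fun i => chainPartial x i ^ 2)
    (fun i _ => sq_nonneg _) (Finset.mem_range.2 (by omega : j + 1 < T + 1)))
  nlinarith

/-- Beyond the first coordinate past the support, the gradient of `chain` vanishes. -/
lemma chainPartial_eq_zero {d k : ℕ} {x : Vec d} (hx : ∀ j, k < j → coord j x = 0) {j : ℕ}
    (hj : k + 1 < j) : chainPartial x j = 0 := by
  obtain ⟨i, rfl⟩ : ∃ i, j = i + 2 := ⟨j - 2, by omega⟩
  simp [chainPartial, hx (i + 2) (by omega), hx (i + 1) (by omega), bumpDeriv_zero, chainWeight,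
    bump_zero]

lemma chainPartial_succ {d k : ℕ} {x : Vec d} (hx : ∀ j, k < j → coord j x = 0) :
    chainPartial x (k + 1) = -chainWeight k (coord k x) := by
  simp [chainPartial, hx (k + 1) (by omega), bumpDeriv_zero, arctanDeriv]

/-! ### The noise potential -/

/-- `exp (-∑_{k ≥ i} x_k²)`. -/
noncomputable def decay {d : ℕ} (i : ℕ) (x : Vec d) : ℝ :=
  Real.exp (-∑ k ∈ Finset.Ico i d, coord k x ^ 2)

/-- A function with bounded gradient, which agrees with `chain` to first order in the first
coordinate past the support of its argument. -/
noncomputable def chainNoise (T : ℕ) (x : Vec (T + 1)) : ℝ :=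
  -∑ j ∈ Finset.range T, coord (j + 1) x * decay (j + 1) x * chainWeight j (coord j x)

/-- The partial derivatives of `chainNoise`. -/
noncomputable def chainNoisePartial {d : ℕ} (x : Vec d) : ℕ → ℝ
  | 0 => 0
  | j + 1 => -(decay (j + 1) x * chainWeight j (coord j x))
      + 2 * coord (j + 1) x * (∑ i ∈ Finset.range (j + 1),
          coord (i + 1) x * decay (i + 1) x * chainWeight i (coord i x))
      - coord (j + 2) x * decay (j + 2) x * bumpDeriv (coord (j + 1) x)

lemma decay_pos {d : ℕ} (i : ℕ) (x : Vec d) : 0 < decay i x := Real.exp_pos _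

lemma decay_le_one {d : ℕ} (i : ℕ) (x : Vec d) : decay i x ≤ 1 :=
  Real.exp_le_one_iff.2 (neg_nonpos.2 (Finset.sum_nonneg fun _ _ => sq_nonneg _))

lemma decay_eq_mul_decay_succ {d : ℕ} (i : ℕ) (x : Vec d) :
    decay i x = Real.exp (-coord i x ^ 2) * decay (i + 1) x := by
  unfold decay
  rw [← Real.exp_add]
  congr 1
  rcases lt_or_ge i d with h | h
  · rw [Finset.sum_eq_sum_Ico_succ_bot h]; ring
  · simp [coord_of_le h, Finset.Ico_eq_empty_of_le h, Finset.Ico_eq_empty_of_le (Nat.le_succ_of_le h)]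

lemma hasFDerivAt_decay {d : ℕ} (i : ℕ) (x : Vec d) :
    HasFDerivAt (fun z : Vec d => decay i z)
      (decay i x • -∑ k ∈ Finset.Ico i d, (2 * coord k x) • (coord k : Vec d →L[ℝ] ℝ)) x := by
  have h : HasFDerivAt (fun z : Vec d => ∑ k ∈ Finset.Ico i d, coord k z ^ 2)
      (∑ k ∈ Finset.Ico i d, (2 * coord k x) • (coord k : Vec d →L[ℝ] ℝ)) x :=
    HasFDerivAt.fun_sum fun k _ =>
      ((hasDerivAt_pow 2 (coord k x)).comp_coord k).congr_fderiv (by simp)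
  exact h.neg.exp

lemma contDiff_decay {d : ℕ} (i : ℕ) : ContDiff ℝ 1 (fun z : Vec d => decay i z) := by
  unfold decay
  fun_prop

lemma contDiff_chainNoise (T : ℕ) : ContDiff ℝ 1 (chainNoise T) := by
  unfold chainNoise
  exact ContDiff.neg (ContDiff.sum fun j _ =>
    (((coord (j + 1)).contDiff.mul (contDiff_decay _)).mul
      ((contDiff_chainWeight j).comp (coord j).contDiff)))

lemma hasFDerivAt_chainNoise (T : ℕ) (x : Vec (T + 1)) :
    HasFDerivAt (chainNoise T)
      (∑ j ∈ Finset.range (T + 1), chainNoisePartial x j • (coord j : Vec (T + 1) →L[ℝ] ℝ)) x := by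
  have hterm : ∀ j ∈ Finset.range T, HasFDerivAt (fun z : Vec (T + 1) =>
      coord (j + 1) z * decay (j + 1) z * chainWeight j (coord j z)) _ x := fun j _ =>
    ((coord (j + 1)).hasFDerivAt.mul (hasFDerivAt_decay (j + 1) x)).mul
      ((hasDerivAt_chainWeight j _).comp_coord j)
  refine ((HasFDerivAt.fun_sum hterm).neg).congr_fderiv ?_
  refine ContinuousLinearMap.ext fun v => ?_
  have hshift := sum_range_eq_sum_range_succ_of_eq_zero (T := T)
    (B := fun j => coord (j + 1) x * decay (j + 1) x * (chainWeightDeriv j (coord j x) * coord j v))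
    (by simp [chainWeightDeriv]) (by simp [coord_of_le])
  -- Coordinate `k + 1` occurs in the decay factor of every term `i ≤ k`; exchanging the sums
  -- collects these contributions.
  have hswap : ∑ j ∈ Finset.range T, chainWeight j (coord j x) * (coord (j + 1) x *
        (decay (j + 1) x * ∑ k ∈ Finset.Ico (j + 1) (T + 1), 2 * coord k x * coord k v))
      = ∑ k ∈ Finset.range T, 2 * coord (k + 1) x * (∑ i ∈ Finset.range (k + 1),
          coord (i + 1) x * decay (i + 1) x * chainWeight i (coord i x)) * coord (k + 1) v := by
    have h1 : ∀ j, ∑ k ∈ Finset.Ico (j + 1) (T + 1), 2 * coord k x * coord k v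
        = ∑ k ∈ Finset.Ico j T, 2 * coord (k + 1) x * coord (k + 1) v := fun j =>
      (Finset.sum_Ico_add' (fun k => 2 * coord k x * coord k v) j T 1).symm
    simp only [h1, Finset.mul_sum, Finset.sum_mul]
    rw [Finset.sum_comm' (t' := Finset.range T) (s' := fun k => Finset.range (k + 1))]
    · refine Finset.sum_congr rfl fun k _ => Finset.sum_congr rfl fun i _ => ?_
      ring
    · intro i k
      simp only [Finset.mem_range, Finset.mem_Ico]
      omega
  rw [Finset.sum_range_succ']
  simp only [sum_apply, neg_apply, add_apply, smul_apply, smul_eq_mul, Pi.mul_apply,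
    Finset.sum_add_distrib, chainNoisePartial, mul_add, mul_neg, Finset.sum_neg_distrib, hswap, hshift, zero_mul, add_zero]
  rw [← Finset.sum_neg_distrib, ← Finset.sum_add_distrib, ← Finset.sum_add_distrib,
    ← Finset.sum_neg_distrib]
  refine Finset.sum_congr rfl fun j _ => ?_
  simp only [chainWeightDeriv]
  ring

lemma hasGradientAt_chainNoise (T : ℕ) (x : Vec (T + 1)) :
    HasGradientAt (chainNoise T) (ofSeq (T + 1) (chainNoisePartial x)) x :=
  hasGradientAt_ofSeq (hasFDerivAt_chainNoise T x)

/-! ### Dimension-free bound for the gradient of the noise potential. -/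

/-- `√(decay i x)`. -/
noncomputable def halfDecay {d : ℕ} (i : ℕ) (x : Vec d) : ℝ :=
  Real.exp (-(∑ k ∈ Finset.Ico i d, coord k x ^ 2) / 2)

lemma halfDecay_sq {d : ℕ} (i : ℕ) (x : Vec d) : halfDecay i x ^ 2 = decay i x := by
  unfold halfDecay decay
  rw [← Real.exp_nat_mul]
  congr 1
  push_cast; ring

lemma halfDecay_pos {d : ℕ} (i : ℕ) (x : Vec d) : 0 < halfDecay i x := Real.exp_pos _

lemma coord_sq_mul_decay_le_one {d : ℕ} (i : ℕ) (x : Vec d) :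
    coord i x ^ 2 * decay i x ≤ 1 := by
  rw [decay_eq_mul_decay_succ, ← mul_assoc]
  exact mul_le_one₀ ((sq_mul_exp_le_bump _).trans (bump_le_one _)) (decay_pos _ _).le
    (decay_le_one _ _)

lemma abs_coord_mul_decay_le {d : ℕ} (i : ℕ) (x : Vec d) :
    |coord i x| * decay i x ≤ halfDecay i x := by
  have h := coord_sq_mul_decay_le_one i x
  refine (sq_le_sq₀ (by have := decay_pos i x; positivity) (halfDecay_pos i x).le).1 ?_
  rw [halfDecay_sq, mul_pow, sq_abs]
  nlinarith [decay_pos i x]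

/-- Each term is at most `halfDecay` times its weight. With `q = exp (-x²/2)` for `x = coord (j +
1)` at the new step, the induction reduces to `2q + (1 - q²) ≤ 2`, that is `(1 - q)² ≥ 0`, so the
bound does not grow with `j`. -/
lemma abs_sum_coord_mul_decay_le {d : ℕ} (x : Vec d) (j : ℕ) :
    |∑ i ∈ Finset.range (j + 1), coord (i + 1) x * decay (i + 1) x * chainWeight i (coord i x)|
      ≤ 2 * halfDecay (j + 1) x := by
  have hterm : ∀ i, |coord (i + 1) x * decay (i + 1) x * chainWeight i (coord i x)|
      ≤ halfDecay (i + 1) x * chainWeight i (coord i x) := fun i => by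
    rw [abs_mul, abs_mul, abs_of_pos (decay_pos _ _), abs_of_nonneg (chainWeight_nonneg _ _)]
    exact mul_le_mul_of_nonneg_right (abs_coord_mul_decay_le _ _) (chainWeight_nonneg _ _)
  induction j with
  | zero =>
    have h1 := hterm 0
    have h2 := halfDecay_pos 1 x
    simp only [chainWeight, mul_one, Nat.reduceAdd] at h1
    simp only [Finset.sum_range_succ, Finset.range_zero, Finset.sum_empty, zero_add, chainWeight,
      mul_one]
    linarith
  | succ j ih =>
    rw [Finset.sum_range_succ]
    refine (abs_add_le _ _).trans ((add_le_add ih (hterm (j + 1))).trans ?_)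
    have hq : halfDecay (j + 1) x
        = Real.exp (-coord (j + 1) x ^ 2 / 2) * halfDecay (j + 2) x := by
      refine (pow_left_inj₀ (halfDecay_pos _ _).le
        (mul_pos (Real.exp_pos _) (halfDecay_pos _ _)).le two_ne_zero).1 ?_
      rw [mul_pow, halfDecay_sq, halfDecay_sq, decay_eq_mul_decay_succ, ← Real.exp_nat_mul]
      congr 2
      push_cast; ring
    have hb : bump (coord (j + 1) x) = 1 - Real.exp (-coord (j + 1) x ^ 2 / 2) ^ 2 := by
      unfold bump
      rw [← Real.exp_nat_mul]
      congr 2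
      push_cast; ring
    simp only [chainWeight]
    rw [hq, hb]
    nlinarith [mul_nonneg (sq_nonneg (Real.exp (-coord (j + 1) x ^ 2 / 2) - 1))
      (halfDecay_pos (j + 2) x).le]

/-- The right-hand side is chosen to sum without a factor `T`: its second part telescopes, and its
first part does so after inserting `chainWeight = 1 - exp (-u²)`. -/
lemma chainNoisePartial_sq_le {d : ℕ} (x : Vec d) (j : ℕ) :
    chainNoisePartial x (j + 1) ^ 2 ≤ 3 * (decay (j + 1) x * chainWeight j (coord j x))
      + 60 * (decay (j + 2) x - decay (j + 1) x) := by
  set a := decay (j + 1) x * chainWeight j (coord j x) with ha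
  set b := coord (j + 1) x * (∑ i ∈ Finset.range (j + 1),
    coord (i + 1) x * decay (i + 1) x * chainWeight i (coord i x)) with hb
  set c := coord (j + 2) x * decay (j + 2) x * bumpDeriv (coord (j + 1) x) with hc
  have hval : chainNoisePartial x (j + 1) = -a + 2 * b - c := by
    simp only [chainNoisePartial, ha, hb, hc]; ring
  have hdiff : decay (j + 2) x - decay (j + 1) x = decay (j + 2) x * bump (coord (j + 1) x) := by
    rw [decay_eq_mul_decay_succ (j + 1)]; unfold bump; ring
  have ha2 : a ^ 2 ≤ a := by
    have h0 : 0 ≤ a := mul_nonneg (decay_pos _ _).le (chainWeight_nonneg _ _)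
    have h1 : a ≤ 1 := mul_le_one₀ (decay_le_one _ _) (chainWeight_nonneg _ _)
      (chainWeight_le_one _ _)
    nlinarith
  have hb2 : b ^ 2 ≤ 4 * (decay (j + 2) x - decay (j + 1) x) := by
    have h1 := abs_sum_coord_mul_decay_le x j
    have h2 := pow_le_pow_left₀ (abs_nonneg _) h1 2
    rw [sq_abs, mul_pow, halfDecay_sq] at h2
    rw [hb, mul_pow, hdiff]
    have h3 := sq_mul_exp_le_bump (coord (j + 1) x)
    rw [decay_eq_mul_decay_succ] at h2
    have h4 := decay_pos (j + 2) x
    calc _ ≤ coord (j + 1) x ^ 2 * (2 ^ 2 * (Real.exp (-coord (j + 1) x ^ 2) * decay (j + 2) x)) :=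
          mul_le_mul_of_nonneg_left h2 (sq_nonneg _)
      _ = 4 * (decay (j + 2) x * (coord (j + 1) x ^ 2 * Real.exp (-coord (j + 1) x ^ 2))) := by ring
      _ ≤ _ := by gcongr
  have hc2 : c ^ 2 ≤ 4 * (decay (j + 2) x - decay (j + 1) x) := by
    have h1 := coord_sq_mul_decay_le_one (j + 2) x
    have h2 := bumpDeriv_sq_le (coord (j + 1) x)
    have h4 := decay_pos (j + 2) x
    rw [hdiff]
    calc c ^ 2 = coord (j + 2) x ^ 2 * decay (j + 2) x * decay (j + 2) x
            * bumpDeriv (coord (j + 1) x) ^ 2 := by rw [hc]; ring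
      _ ≤ 1 * decay (j + 2) x * (4 * bump (coord (j + 1) x)) := by gcongr
      _ = _ := by ring
  rw [hval]
  -- `(-a + 2b - c)² ≤ 3 (a² + 4b² + c²)`; with `b²` and `c²` at most `4` increments, `60 = 3 * (16
  -- + 4)`.
  nlinarith [sq_nonneg (a + 2 * b), sq_nonneg (a - c), sq_nonneg (2 * b + c)]

lemma norm_ofSeq_chainNoisePartial_sq_le (T : ℕ) (x : Vec (T + 1)) :
    ‖ofSeq (T + 1) (chainNoisePartial x)‖ ^ 2 ≤ 63 := by
  rw [norm_ofSeq_sq, Finset.sum_range_succ']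
  have h1 : ∑ j ∈ Finset.range T, decay (j + 1) x * chainWeight j (coord j x) ≤ 1 := by
    rcases Nat.eq_zero_or_pos T with rfl | hT
    · simp
    obtain ⟨S, rfl⟩ : ∃ S, T = S + 1 := ⟨T - 1, by omega⟩
    -- Since `decay i = exp (-x_i²) * decay (i + 1)`, adding the next term replaces `decay (S + 1)`
    -- by `decay (S + 2)`.
    have : ∀ S, ∑ j ∈ Finset.range (S + 1), decay (j + 1) x * chainWeight j (coord j x)
        = decay (S + 1) x := by
      intro S
      induction S with
      | zero => simp [chainWeight]
      | succ S ih =>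
        rw [Finset.sum_range_succ, ih, decay_eq_mul_decay_succ (S + 1)]
        simp only [chainWeight, bump]
        ring
    rw [this]
    exact decay_le_one _ _
  have h2 : ∑ j ∈ Finset.range T, (decay (j + 2) x - decay (j + 1) x) ≤ 1 := by
    rw [Finset.sum_range_sub (fun j => decay (j + 1) x)]
    linarith [decay_le_one (T + 1) x, decay_pos (0 + 1) x]
  calc _ ≤ ∑ j ∈ Finset.range T, (3 * (decay (j + 1) x * chainWeight j (coord j x))
      + 60 * (decay (j + 2) x - decay (j + 1) x)) + 0 :=
        add_le_add (Finset.sum_le_sum fun j _ => chainNoisePartial_sq_le x j)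
          (by simp [chainNoisePartial])
    _ ≤ 63 := by
        rw [Finset.sum_add_distrib, ← Finset.mul_sum, ← Finset.mul_sum]
        linarith

lemma chainNoisePartial_eq_zero {d k : ℕ} {x : Vec d} (hx : ∀ j, k < j → coord j x = 0) {j : ℕ}
    (hj : k + 1 < j) : chainNoisePartial x j = 0 := by
  obtain ⟨i, rfl⟩ : ∃ i, j = i + 2 := ⟨j - 2, by omega⟩
  simp [chainNoisePartial, hx (i + 2) (by omega), hx (i + 1) (by omega), bumpDeriv_zero,
    chainWeight, bump_zero]

/-- The value is that of `chainPartial_succ`: this agreement turns additive noise into a factor `ξ`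
at the frontier. -/
lemma chainNoisePartial_succ {d k : ℕ} {x : Vec d} (hx : ∀ j, k < j → coord j x = 0) :
    chainNoisePartial x (k + 1) = -chainWeight k (coord k x) := by
  have hdecay : decay (k + 1) x = 1 := by
    unfold decay
    rw [Finset.sum_eq_zero, neg_zero, Real.exp_zero]
    intro j hj
    rw [hx j (by have := Finset.mem_Ico.1 hj; omega)]
    norm_num
  simp [chainNoisePartial, hx (k + 1) (by omega), hdecay, bumpDeriv_zero]

/-! ### A robust aggregator that hides coordinates -/

/-- The mean of the real numbers `z i`, `i ∈ H`. -/
noncomputable def meanOn {ι : Type*} (H : Finset ι) (z : ι → ℝ) : ℝ :=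
  (H.card : ℝ)⁻¹ * ∑ i ∈ H, z i

open Classical in
/-- The mean over `H`, replaced by `0` if it is small compared with the empirical variance. -/
noncomputable def hidingMean {ι : Type*} (K : ℝ) (H : Finset ι) (z : ι → ℝ) : ℝ :=
  if meanOn H z ^ 2 ≤ K / H.card * ∑ i ∈ H, (z i - meanOn H z) ^ 2 then 0 else meanOn H z

/-- The aggregator that applies `hidingMean` to every coordinate in the orthonormal basis given
by `e`. -/
noncomputable def hidingAggregator {n d : ℕ} (e : Vec d ≃ₗᵢ[ℝ] Vec d) (K : ℝ) (H : Finset (Fin n))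
    (w : Fin n → Vec d) : Vec d :=
  e.symm (ofSeq d fun j => hidingMean K H fun i => coord j (e (w i)))

lemma meanOn_eq_zero {ι : Type*} {H : Finset ι} {z : ι → ℝ} (hz : ∀ i ∈ H, z i = 0) :
    meanOn H z = 0 := by
  rw [meanOn, Finset.sum_eq_zero hz, mul_zero]

lemma hidingMean_eq_zero {ι : Type*} {K : ℝ} {H : Finset ι} {z : ι → ℝ}
    (hz : ∀ i ∈ H, z i = 0) : hidingMean K H z = 0 := by
  rw [hidingMean, meanOn_eq_zero hz]
  split_ifs <;> rfl

/-- The threshold in `hidingMean` is exactly the error allowed; summing over orthonormal coordinates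
yields robustness. -/
lemma sq_hidingMean_sub_le {ι : Type*} {K : ℝ} (hK : 0 ≤ K) (H : Finset ι) (z : ι → ℝ) :
    (hidingMean K H z - meanOn H z) ^ 2 ≤ K / H.card * ∑ i ∈ H, (z i - meanOn H z) ^ 2 := by
  unfold hidingMean
  split_ifs with h
  · simpa using h
  · rw [sub_self]
    have : 0 ≤ K / H.card * ∑ i ∈ H, (z i - meanOn H z) ^ 2 := by positivity
    simpa using this

lemma measurable_hidingMean {n : ℕ} (K : ℝ) (H : Finset (Fin n)) :
    Measurable (hidingMean K H) := by
  have hm : Measurable (meanOn H : (Fin n → ℝ) → ℝ) := by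
    unfold meanOn
    fun_prop
  unfold hidingMean
  refine Measurable.ite (measurableSet_le (hm.pow_const 2) (Measurable.const_mul
    (Finset.measurable_fun_sum _ fun i _ => ((measurable_pi_apply i).sub hm).pow_const 2) _))
    measurable_const hm

lemma measurable_hidingAggregator {n d : ℕ} (e : Vec d ≃ₗᵢ[ℝ] Vec d) (K : ℝ)
    (H : Finset (Fin n)) : Measurable (hidingAggregator e K H) := by
  have h1 : Measurable fun (w : Fin n → Vec d) (j : Fin d) =>
      hidingMean K H fun i => coord (j : ℕ) (e (w i)) := by
    refine measurable_pi_lambda _ fun j => (measurable_hidingMean K H).comp ?_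
    exact measurable_pi_lambda _ fun i => ((coord (j : ℕ)).continuous.measurable.comp
      e.continuous.measurable).comp (measurable_pi_apply i)
  exact (e.symm.continuous.measurable.comp
    (PiLp.continuous_toLp 2 (fun _ : Fin d => ℝ)).measurable).comp h1

lemma coord_hidingAggregator {n d j : ℕ} (e : Vec d ≃ₗᵢ[ℝ] Vec d) (K : ℝ) (H : Finset (Fin n))
    (w : Fin n → Vec d) (hj : j < d) :
    coord j (e (hidingAggregator e K H w)) = hidingMean K H fun i => coord j (e (w i)) := by
  rw [hidingAggregator, LinearIsometryEquiv.apply_symm_apply, coord_ofSeq hj]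

lemma coord_honestMean {n d : ℕ} (e : Vec d ≃ₗᵢ[ℝ] Vec d) (H : Finset (Fin n))
    (w : Fin n → Vec d) (j : ℕ) :
    coord j (e (honestMean H w)) = meanOn H fun i => coord j (e (w i)) := by
  simp [honestMean, meanOn]

lemma isRobustAggregator_hidingAggregator {n d : ℕ} (e : Vec d ≃ₗᵢ[ℝ] Vec d) {ρ δ : ℝ}
    (hK : 0 ≤ ρ * δ) {H : Finset (Fin n)} (hH : (1 - δ) * n ≤ H.card) :
    IsRobustAggregator ρ δ H (hidingAggregator e (ρ * δ) H) where
  measurable := measurable_hidingAggregator e _ H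
  card_honest := hH
  robust w := by
    have hnorm : ∀ u v : Vec d, ‖u - v‖ ^ 2
        = ∑ j ∈ Finset.range d, (coord j (e u) - coord j (e v)) ^ 2 := fun u v => by
      rw [← e.norm_map, norm_sq_eq_sum_coord]
      simp
    simp only [hnorm, coord_honestMean]
    rw [Finset.sum_comm, Finset.mul_sum]
    refine Finset.sum_le_sum fun j hj => ?_
    rw [coord_hidingAggregator e _ H w (Finset.mem_range.1 hj)]
    exact sq_hidingMean_sub_le hK H _

/-! ### Values whose mean the aggregator may hide. -/

/-- If all but few of the numbers vanish, their mean is hidden. -/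
lemma sq_meanOn_le_of_few_nonzero {ι : Type*} [DecidableEq ι] {K : ℝ} (hK : 0 ≤ K)
    {H C : Finset ι} (hC : C ⊆ H) (hH : 0 < H.card)
    (hcard : (C.card : ℝ) < K / (1 + K) * H.card) {z : ι → ℝ} (hz : ∀ i ∈ H \ C, z i = 0) :
    meanOn H z ^ 2 ≤ K / H.card * ∑ i ∈ H, (z i - meanOn H z) ^ 2 := by
  have hh : (0 : ℝ) < H.card := by exact_mod_cast hH
  have hsum : ∑ i ∈ H, z i = ∑ i ∈ C, z i := by
    rw [← Finset.sum_sdiff hC, Finset.sum_eq_zero hz, zero_add]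
  have hsq : ∑ i ∈ C, z i ^ 2 ≤ ∑ i ∈ H, z i ^ 2 :=
    Finset.sum_le_sum_of_subset_of_nonneg hC fun _ _ _ => sq_nonneg _
  -- Cauchy–Schwarz on the few nonzero entries gives the factor `|C|` instead of `|H|`.
  have hcs := sq_sum_le_card_mul_sum_sq (s := C) (f := z)
  rw [← hsum] at hcs
  set μ := meanOn H z with hμ
  have hmean : ∑ i ∈ H, z i = H.card * μ := by
    rw [hμ, meanOn]; field_simp
  have hvar : ∑ i ∈ H, (z i - μ) ^ 2 = ∑ i ∈ H, z i ^ 2 - H.card * μ ^ 2 := by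
    simp only [sub_sq, Finset.sum_add_distrib, Finset.sum_sub_distrib, ← Finset.mul_sum,
      ← Finset.sum_mul, hmean, Finset.sum_const, nsmul_eq_mul]
    ring
  have hQ : 0 ≤ ∑ i ∈ H, z i ^ 2 := Finset.sum_nonneg fun _ _ => sq_nonneg _
  set Q := ∑ i ∈ H, z i ^ 2 with hQdef
  rw [hmean] at hcs
  have h1 : (H.card * μ) ^ 2 ≤ K / (1 + K) * H.card * Q :=
    hcs.trans ((mul_le_mul_of_nonneg_left hsq (Nat.cast_nonneg _)).trans
      (mul_le_mul_of_nonneg_right hcard.le hQ))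
  have h2 : (1 + K) * (H.card * μ ^ 2) ≤ K * Q := by
    have h3 : K / (1 + K) * H.card * Q = H.card * (K * Q / (1 + K)) := by ring
    rw [h3, mul_pow, sq (H.card : ℝ), mul_assoc] at h1
    have h4 := le_of_mul_le_mul_left h1 hh
    rw [le_div_iff₀ (by positivity)] at h4
    linarith
  rw [hvar, div_mul_eq_mul_div, le_div_iff₀ hh]
  linarith

/-- If most of the numbers are spread evenly over two separated values, their mean is hidden. -/
lemma sq_meanOn_le_of_spread {ι : Type*} [DecidableEq ι] {K η S : ℝ} (hK : 6 ≤ K)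
    (hKη : K * η ^ 2 = 6) {H₁ H₂ H C : Finset ι} (hdisj : Disjoint H₁ H₂) (hunion : H₁ ∪ H₂ = H)
    (hH : 0 < H.card) (h₁ : H.card ≤ 3 * H₁.card) (h₂ : H.card ≤ 3 * H₂.card)
    (hcard : (C.card : ℝ) < 1 / 6 * H.card) {z : ι → ℝ}
    (hz₁ : ∀ i ∈ H₁ \ C, z i = (1 + η) * S) (hz₂ : ∀ i ∈ H₂ \ C, z i = (1 - η) * S) :
    meanOn H z ^ 2 ≤ K / H.card * ∑ i ∈ H, (z i - meanOn H z) ^ 2 := by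
  have hh : (0 : ℝ) < H.card := by exact_mod_cast hH
  generalize meanOn H z = μ
  -- Each group keeps at least `1/3 - 1/6 = 1/6` of the nodes after removal of `C`.
  have hpart : ∀ (G : Finset ι) (v : ℝ), H.card ≤ 3 * G.card → (∀ i ∈ G \ C, z i = v) →
      H.card / 6 * (v - μ) ^ 2 ≤ ∑ i ∈ G, (z i - μ) ^ 2 := by
    intro G v hG hv
    have hc1 : (G.card : ℝ) ≤ (G \ C).card + C.card := by
      exact_mod_cast Finset.card_le_card_sdiff_add_card
    have hc2 : (H.card : ℝ) ≤ 3 * G.card := by exact_mod_cast hG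
    have hc3 : (H.card : ℝ) / 6 ≤ (G \ C).card := by linarith
    calc _ ≤ ((G \ C).card : ℝ) * (v - μ) ^ 2 :=
          mul_le_mul_of_nonneg_right hc3 (sq_nonneg _)
      _ = ∑ i ∈ G \ C, (z i - μ) ^ 2 := by
          rw [Finset.sum_congr rfl fun i hi => by rw [hv i hi], Finset.sum_const, nsmul_eq_mul]
      _ ≤ _ := Finset.sum_le_sum_of_subset_of_nonneg Finset.sdiff_subset
          fun _ _ _ => sq_nonneg _
  have hp1 := hpart H₁ _ h₁ hz₁
  have hp2 := hpart H₂ _ h₂ hz₂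
  have hsum : ∑ i ∈ H, (z i - μ) ^ 2 = ∑ i ∈ H₁, (z i - μ) ^ 2 + ∑ i ∈ H₂, (z i - μ) ^ 2 := by
    rw [← hunion, Finset.sum_union hdisj]
  have hlow : H.card / 3 * ((S - μ) ^ 2 + η ^ 2 * S ^ 2) ≤ ∑ i ∈ H, (z i - μ) ^ 2 := by
    rw [hsum]
    refine le_trans (le_of_eq ?_) (add_le_add hp1 hp2)
    ring
  rw [div_mul_eq_mul_div, le_div_iff₀ hh]
  calc μ ^ 2 * H.card ≤ K * (H.card / 3 * ((S - μ) ^ 2 + η ^ 2 * S ^ 2)) := by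
        have : K * (H.card / 3 * ((S - μ) ^ 2 + η ^ 2 * S ^ 2))
            = (K * (S - μ) ^ 2 + (K * η ^ 2) * S ^ 2) / 3 * H.card := by ring
        rw [this, hKη]
        refine mul_le_mul_of_nonneg_right ?_ hh.le
        -- `2 (S - μ)² + 2S² - μ² = (2S - μ)²`.
        nlinarith [mul_nonneg (sub_nonneg.2 hK) (sq_nonneg (S - μ)), sq_nonneg (2 * S - μ)]
    _ ≤ _ := mul_le_mul_of_nonneg_left hlow (by linarith)

/-- Typical noise factors `good i` such that the mean of the common multiple `S * good i` is
hidden as long as the fraction of nodes with atypical values is smaller than `θ`. -/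
lemma exists_typical_factors {ι : Type*} [DecidableEq ι] {K : ℝ} (hK : 0 ≤ K) {H : Finset ι}
    (hH : 2 ≤ H.card) :
    ∃ (good : ι → ℝ) (η θ : ℝ), 0 < η ∧ 0 ≤ θ ∧ (∀ i, |good i - 1| = η) ∧
      K * η ^ 2 ≤ 36 * θ ∧ ∀ (z : ι → ℝ) (S : ℝ) (C : Finset ι), C ⊆ H →
        (C.card : ℝ) < θ * H.card → (∀ i ∈ H \ C, z i = good i * S) →
        meanOn H z ^ 2 ≤ K / H.card * ∑ i ∈ H, (z i - meanOn H z) ^ 2 := by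
  rcases le_total K 6 with h6 | h6
  -- Small `K`: typical samples erase the frontier coordinate entirely, so only contaminated nodes
  -- report it.
  · refine ⟨fun _ => 0, 1, K / (1 + K), one_pos, by positivity, by simp, ?_, ?_⟩
    · rw [mul_div_assoc', le_div_iff₀ (by positivity)]
      nlinarith
    · intro z S C hC hcard hz
      exact sq_meanOn_le_of_few_nonzero hK hC (by omega) hcard fun i hi => by simp [hz i hi]
  -- Large `K`: factors `1 ± η` on two halves, with `η² = 6/K`, already create enough variance. Less
  -- noise is needed, so rare samples can be rarer.
  · obtain ⟨H₁, hH₁, hcard₁⟩ := Finset.exists_subset_card_eq (s := H) (n := H.card / 2) (by omega)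
    have hcard₂ : (H \ H₁).card = H.card - H.card / 2 := by
      rw [Finset.card_sdiff_of_subset hH₁, hcard₁]
    have hη : 0 < √(6 / K) := Real.sqrt_pos.2 (by positivity)
    have hη2 : √(6 / K) ^ 2 = 6 / K := Real.sq_sqrt (by positivity)
    refine ⟨fun i => if i ∈ H₁ then 1 + √(6 / K) else 1 - √(6 / K), √(6 / K), 1 / 6, hη,
      by norm_num, fun i => ?_, ?_, ?_⟩
    · dsimp only
      split_ifs
      · rw [add_sub_cancel_left, abs_of_pos hη]
      · rw [sub_sub_cancel_left, abs_neg, abs_of_pos hη]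
    · rw [hη2, mul_div_cancel₀ _ (by positivity)]; norm_num
    · intro z S C hC hcard hz
      refine sq_meanOn_le_of_spread (S := S) (η := √(6 / K)) h6 ?_ Finset.disjoint_sdiff
        (Finset.union_sdiff_of_subset hH₁) (by omega) (by omega) (by omega) hcard ?_ ?_
      · rw [hη2, mul_div_cancel₀ _ (by positivity)]
      · intro i hi
        rw [Finset.mem_sdiff] at hi
        simp only [hz i (Finset.mem_sdiff.2 ⟨hH₁ hi.1, hi.2⟩), if_pos hi.1]
      · intro i hi
        simp only [Finset.mem_sdiff] at hi
        simp only [hz i (Finset.mem_sdiff.2 ⟨hi.1.1, hi.2⟩), if_neg hi.1.2]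

/-! ### The hard instance -/

/-- The function `x ↦ lam * φ (e x / r)`. -/
noncomputable def rescale {d : ℕ} (e : Vec d ≃ₗᵢ[ℝ] Vec d) (lam r : ℝ) (φ : Vec d → ℝ)
    (x : Vec d) : ℝ :=
  lam * φ (r⁻¹ • e x)

lemma hasGradientAt_rescale {d : ℕ} (e : Vec d ≃ₗᵢ[ℝ] Vec d) (lam r : ℝ) {φ : Vec d → ℝ}
    {g x : Vec d} (h : HasGradientAt φ g (r⁻¹ • e x)) :
    HasGradientAt (rescale e lam r φ) ((lam / r) • e.symm g) x := by
  rw [hasGradientAt_iff_hasFDerivAt] at h ⊢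
  have h1 : HasFDerivAt (fun z : Vec d => r⁻¹ • e z)
      (r⁻¹ • (e.toContinuousLinearEquiv : Vec d →L[ℝ] Vec d)) x :=
    e.toContinuousLinearEquiv.hasFDerivAt.const_smul r⁻¹
  refine ((h.comp x h1).const_mul lam).congr_fderiv (ContinuousLinearMap.ext fun v => ?_)
  have h2 : inner ℝ g (e v) = inner ℝ (e.symm g) v := by
    rw [← e.inner_map_map (e.symm g) v, e.apply_symm_apply]
  simp [h2]
  ring

lemma contDiff_rescale {d : ℕ} (e : Vec d ≃ₗᵢ[ℝ] Vec d) (lam r : ℝ) {φ : Vec d → ℝ}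
    (h : ContDiff ℝ 1 φ) : ContDiff ℝ 1 (rescale e lam r φ) :=
  contDiff_const.mul (h.comp (e.contDiff.const_smul r⁻¹))

/-! ### Two-point sample distributions and the resulting problem. -/

/-- The distribution of a scalar that is `a` with probability `1 - p` and `b` with
probability `p`. -/
noncomputable def twoPoint (p a b : ℝ) : Measure (Vec 1) :=
  ENNReal.ofReal (1 - p) • Measure.dirac (ofSeq 1 fun _ => a)
    + ENNReal.ofReal p • Measure.dirac (ofSeq 1 fun _ => b)

lemma isProbabilityMeasure_twoPoint {p : ℝ} (h0 : 0 ≤ p) (h1 : p ≤ 1) (a b : ℝ) :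
    IsProbabilityMeasure (twoPoint p a b) := by
  constructor
  simp only [twoPoint, Measure.add_apply, Measure.smul_apply, measure_univ, smul_eq_mul, mul_one]
  rw [← ENNReal.ofReal_add (by linarith) h0]
  simp

lemma integrable_twoPoint {E : Type*} [NormedAddCommGroup E] (p a b : ℝ) (h : Vec 1 → E) :
    Integrable h (twoPoint p a b) :=
  ((integrable_dirac (by simp)).smul_measure ENNReal.ofReal_ne_top).add_measure
    ((integrable_dirac (by simp)).smul_measure ENNReal.ofReal_ne_top)

lemma integral_twoPoint {E : Type*} [NormedAddCommGroup E] [NormedSpace ℝ E] [CompleteSpace E]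
    {p : ℝ} (h0 : 0 ≤ p) (h1 : p ≤ 1) (a b : ℝ) (h : Vec 1 → E) :
    ∫ ξ, h ξ ∂(twoPoint p a b)
      = (1 - p) • h (ofSeq 1 fun _ => a) + p • h (ofSeq 1 fun _ => b) := by
  have hi : ∀ (c q : ℝ), Integrable h
      (ENNReal.ofReal q • Measure.dirac (ofSeq 1 fun _ => c : Vec 1)) := fun c q =>
    (integrable_dirac (by simp)).smul_measure ENNReal.ofReal_ne_top
  rw [twoPoint, integral_add_measure (hi _ _) (hi _ _), integral_smul_measure,
    integral_smul_measure, integral_dirac, integral_dirac, ENNReal.toReal_ofReal (by linarith),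
    ENNReal.toReal_ofReal h0]

lemma lintegral_twoPoint (p a b : ℝ) (h : Vec 1 → ENNReal) :
    ∫⁻ ξ, h ξ ∂(twoPoint p a b) = ENNReal.ofReal (1 - p) * h (ofSeq 1 fun _ => a)
      + ENNReal.ofReal p * h (ofSeq 1 fun _ => b) := by
  rw [twoPoint, lintegral_add_measure, lintegral_smul_measure, lintegral_smul_measure,
    lintegral_dirac, lintegral_dirac, smul_eq_mul, smul_eq_mul]

lemma twoPoint_ne_le (p a b : ℝ) :
    twoPoint p a b {ξ | ξ ≠ ofSeq 1 fun _ => a} ≤ ENNReal.ofReal p := by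
  have h : {ξ : Vec 1 | ξ ≠ ofSeq 1 fun _ => a} = {ofSeq 1 fun _ => a}ᶜ := rfl
  rw [h, twoPoint, Measure.add_apply, Measure.smul_apply, Measure.smul_apply]
  have h1 : Measure.dirac (ofSeq 1 fun _ => a : Vec 1) {ofSeq 1 fun _ => a}ᶜ = 0 := by simp
  rw [h1, smul_zero, zero_add, smul_eq_mul]
  exact mul_le_of_le_one_right' prob_le_one

/-- The data of a hard instance with a chain of length `T`. -/
structure ChainInstance (n T : ℕ) where
  /-- the rotation of the space -/
  e : Vec (T + 1) ≃ₗᵢ[ℝ] Vec (T + 1)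
  /-- the scale of the function values -/
  lam : ℝ
  /-- the scale of the arguments -/
  r : ℝ
  /-- the probability of an atypical sample -/
  p : ℝ
  /-- the typical noise factors of the nodes -/
  good : Fin n → ℝ
  /-- the honest nodes -/
  H : Finset (Fin n)
  p_pos : 0 < p
  p_le_one : p ≤ 1
  majority : Hᶜ.card < H.card

namespace ChainInstance

variable {n T : ℕ}

/-- The atypical noise factor, such that the mean is `1`. -/
noncomputable def rare (I : ChainInstance n T) (i : Fin n) : ℝ :=
  1 - (I.good i - 1) * (1 - I.p) / I.p

lemma mean_factor (I : ChainInstance n T) (i : Fin n) :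
    (1 - I.p) * (I.good i - 1) + I.p * (I.rare i - 1) = 0 := by
  have := I.p_pos.ne'
  unfold rare
  field_simp
  ring

lemma variance_factor (I : ChainInstance n T) (i : Fin n) :
    (1 - I.p) * (I.good i - 1) ^ 2 + I.p * (I.rare i - 1) ^ 2
      = (I.good i - 1) ^ 2 * (1 - I.p) / I.p := by
  have := I.p_pos.ne'
  unfold rare
  field_simp
  ring

/-- The distributed problem of a hard instance: the data are random factors of the noise
potential. -/
noncomputable def problem (I : ChainInstance n T) : DistProblem n (T + 1) where
  q := 1
  H := I.H
  D i := twoPoint I.p (I.good i) (I.rare i)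
  F x ξ := rescale I.e I.lam I.r (chain T) x
    + (coord 0 ξ - 1) * rescale I.e I.lam I.r (chainNoise T) x
  honest_majority := I.majority
  prob i := isProbabilityMeasure_twoPoint I.p_pos.le I.p_le_one _ _
  measurable_F := by
    refine Continuous.measurable ?_
    have h1 := (contDiff_rescale I.e I.lam I.r (contDiff_chain T)).continuous
    have h2 := (contDiff_rescale I.e I.lam I.r (contDiff_chainNoise T)).continuous
    exact (h1.comp continuous_fst).add
      ((((coord 0).continuous.comp continuous_snd).sub continuous_const).mul
        (h2.comp continuous_fst))
  integrable_F i _ x := integrable_twoPoint _ _ _ _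

lemma card_H_pos (I : ChainInstance n T) : 0 < I.H.card := (Nat.zero_le _).trans_lt I.majority

lemma localLoss_problem (I : ChainInstance n T) (i : Fin n) :
    I.problem.localLoss i = rescale I.e I.lam I.r (chain T) := by
  funext x
  have h := I.mean_factor i
  simp only [DistProblem.localLoss, problem]
  refine (integral_twoPoint I.p_pos.le I.p_le_one _ _ _).trans ?_
  rw [coord_ofSeq one_pos, coord_ofSeq one_pos, smul_eq_mul, smul_eq_mul]
  linear_combination rescale I.e I.lam I.r (chainNoise T) x * h

lemma loss_problem (I : ChainInstance n T) :
    I.problem.loss = rescale I.e I.lam I.r (chain T) := by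
  funext x
  have h : (I.H.card : ℝ) ≠ 0 := by exact_mod_cast I.card_H_pos.ne'
  simp only [DistProblem.loss, localLoss_problem, Finset.sum_const, nsmul_eq_mul]
  exact inv_mul_cancel_left₀ h _

lemma hasGradientAt_chain_rescale (I : ChainInstance n T) (x : Vec (T + 1)) :
    HasGradientAt (rescale I.e I.lam I.r (chain T))
      ((I.lam / I.r) • I.e.symm (ofSeq (T + 1) (chainPartial (I.r⁻¹ • I.e x)))) x :=
  hasGradientAt_rescale _ _ _ (hasGradientAt_chain T _)

lemma gradient_chain_rescale (I : ChainInstance n T) (x : Vec (T + 1)) :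
    gradient (rescale I.e I.lam I.r (chain T)) x
      = (I.lam / I.r) • I.e.symm (ofSeq (T + 1) (chainPartial (I.r⁻¹ • I.e x))) :=
  (I.hasGradientAt_chain_rescale x).gradient

lemma stochGrad_problem (I : ChainInstance n T) (x : Vec (T + 1)) (ξ : Vec 1) :
    I.problem.stochGrad x ξ
      = (I.lam / I.r) • I.e.symm (ofSeq (T + 1) (chainPartial (I.r⁻¹ • I.e x)))
        + (coord 0 ξ - 1) • (I.lam / I.r) •
          I.e.symm (ofSeq (T + 1) (chainNoisePartial (I.r⁻¹ • I.e x))) := by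
  refine HasGradientAt.gradient ?_
  have h1 := (I.hasGradientAt_chain_rescale x).hasFDerivAt
  have h2 := (hasGradientAt_rescale I.e I.lam I.r
    (hasGradientAt_chainNoise T (I.r⁻¹ • I.e x))).hasFDerivAt
  rw [hasGradientAt_iff_hasFDerivAt]
  refine (h1.add (h2.const_mul (coord 0 ξ - 1))).congr_fderiv ?_
  simp

lemma coord_stochGrad_problem (I : ChainInstance n T) (x : Vec (T + 1)) (ξ : Vec 1) {j : ℕ}
    (hj : j < T + 1) :
    coord j (I.e (I.problem.stochGrad x ξ))
      = (I.lam / I.r) * (chainPartial (I.r⁻¹ • I.e x) j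
        + (coord 0 ξ - 1) * chainNoisePartial (I.r⁻¹ • I.e x) j) := by
  rw [stochGrad_problem]
  simp only [map_add, map_smul, LinearIsometryEquiv.apply_symm_apply, coord_ofSeq hj, smul_eq_mul]
  ring

/-- The noise factor has mean `1` and variance `η² (1 - p) / p`; it multiplies a vector of squared
norm at most `63 (lam / r)²`. -/
lemma inOracleClass_problem (I : ChainInstance n T) {η σ : ℝ} (hη : ∀ i, |I.good i - 1| = η)
    (hσ : (I.lam / I.r) ^ 2 * 63 * η ^ 2 * (1 - I.p) ≤ σ ^ 2 * I.p) :
    I.problem.InOracleClass (σ ^ 2) where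
  contDiff_F ξ := (contDiff_rescale I.e I.lam I.r (contDiff_chain T)).add
    (contDiff_const.mul (contDiff_rescale I.e I.lam I.r (contDiff_chainNoise T)))
  integrable i _ x := integrable_twoPoint _ _ _ _
  unbiased i _ x := by
    rw [localLoss_problem, gradient_chain_rescale]
    refine (integral_twoPoint I.p_pos.le I.p_le_one _ _ _).trans ?_
    rw [stochGrad_problem, stochGrad_problem, coord_ofSeq one_pos, coord_ofSeq one_pos]
    generalize (I.lam / I.r) • I.e.symm (ofSeq (T + 1) (chainPartial (I.r⁻¹ • I.e x))) = u
    generalize (I.lam / I.r) • I.e.symm (ofSeq (T + 1) (chainNoisePartial (I.r⁻¹ • I.e x))) = v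
    have : (1 - I.p) • (u + (I.good i - 1) • v) + I.p • (u + (I.rare i - 1) • v)
        = u + ((1 - I.p) * (I.good i - 1) + I.p * (I.rare i - 1)) • v := by module
    rw [this, I.mean_factor, zero_smul, add_zero]
  variance i _ x := by
    rw [localLoss_problem, gradient_chain_rescale]
    refine (lintegral_twoPoint _ _ _ _).trans_le ?_
    rw [stochGrad_problem, stochGrad_problem, coord_ofSeq one_pos, coord_ofSeq one_pos,
      add_sub_cancel_left, add_sub_cancel_left]
    have hnorm := norm_ofSeq_chainNoisePartial_sq_le T (I.r⁻¹ • I.e x)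
    have hv : ‖(I.lam / I.r) • I.e.symm (ofSeq (T + 1) (chainNoisePartial (I.r⁻¹ • I.e x)))‖ ^ 2
        ≤ (I.lam / I.r) ^ 2 * 63 := by
      rw [norm_smul, mul_pow, Real.norm_eq_abs, sq_abs, LinearIsometryEquiv.norm_map]
      exact mul_le_mul_of_nonneg_left hnorm (sq_nonneg _)
    generalize (I.lam / I.r) • I.e.symm (ofSeq (T + 1) (chainNoisePartial (I.r⁻¹ • I.e x))) = v
      at hv
    have henorm : ∀ a : ℝ, ‖a • v‖ₑ ^ 2 = ENNReal.ofReal (a ^ 2 * ‖v‖ ^ 2) := fun a => by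
      rw [← ofReal_norm, ← ENNReal.ofReal_pow (norm_nonneg _), norm_smul, mul_pow,
        Real.norm_eq_abs, sq_abs]
    have hp := I.p_pos
    have hp1 : 0 ≤ 1 - I.p := sub_nonneg.2 I.p_le_one
    rw [henorm, henorm, ← ENNReal.ofReal_mul hp1, ← ENNReal.ofReal_mul hp.le,
      ← ENNReal.ofReal_add (by positivity) (by positivity)]
    refine ENNReal.ofReal_le_ofReal ?_
    have hvar := I.variance_factor i
    have hη2 : (I.good i - 1) ^ 2 = η ^ 2 := by rw [← hη i, sq_abs]
    rw [hη2] at hvar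
    calc _ = ((1 - I.p) * (I.good i - 1) ^ 2 + I.p * (I.rare i - 1) ^ 2) * ‖v‖ ^ 2 := by ring
      _ = η ^ 2 * (1 - I.p) / I.p * ‖v‖ ^ 2 := by rw [← hvar, hη2]
      _ ≤ η ^ 2 * (1 - I.p) / I.p * ((I.lam / I.r) ^ 2 * 63) := by gcongr
      _ = (I.lam / I.r) ^ 2 * 63 * η ^ 2 * (1 - I.p) / I.p := by ring
      _ ≤ σ ^ 2 := by rwa [div_le_iff₀ hp]

lemma abs_rescale_chain_le (I : ChainInstance n T) (x : Vec (T + 1)) :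
    |rescale I.e I.lam I.r (chain T) x| ≤ |I.lam| * (4 * T) := by
  rw [rescale, abs_mul]
  exact mul_le_mul_of_nonneg_left (abs_chain_le T _) (abs_nonneg _)

lemma inFunctionClass_problem (I : ChainInstance n T) {L : ℝ} (hr : 0 < I.r) (hlam : 0 < I.lam)
    (hL : 11 * I.lam ≤ L * I.r ^ 2) : I.problem.InFunctionClass L 0 where
  contDiff_loss := by
    rw [loss_problem]
    exact contDiff_rescale _ _ _ (contDiff_chain T)
  bddBelow i _ := by
    refine ⟨-(|I.lam| * (4 * T)), ?_⟩
    rintro _ ⟨x, rfl⟩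
    rw [localLoss_problem]
    exact (abs_le.1 (I.abs_rescale_chain_le x)).1
  differentiable i _ := by
    rw [localLoss_problem]
    exact (contDiff_rescale _ _ _ (contDiff_chain T)).differentiable one_ne_zero
  smooth i _ x y := by
    rw [localLoss_problem, gradient_chain_rescale, gradient_chain_rescale, ← smul_sub, ← map_sub,
      norm_smul, LinearIsometryEquiv.norm_map, Real.norm_of_nonneg (by positivity)]
    have h := norm_ofSeq_chainPartial_sub_le T (I.r⁻¹ • I.e x) (I.r⁻¹ • I.e y)
    rw [← smul_sub, ← map_sub, norm_smul, LinearIsometryEquiv.norm_map,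
      Real.norm_of_nonneg (by positivity)] at h
    calc _ ≤ I.lam / I.r * (11 * (I.r⁻¹ * ‖x - y‖)) := by gcongr
      _ = 11 * I.lam / I.r ^ 2 * ‖x - y‖ := by field_simp
      _ ≤ L * ‖x - y‖ := by
        refine mul_le_mul_of_nonneg_right ?_ (norm_nonneg _)
        rwa [div_le_iff₀ (by positivity)]
  heterogeneity x := by
    simp [loss_problem, localLoss_problem]

end ChainInstance

/-! ### Non-convexity of the local functions. -/

/-- A convex function on the whole space that is bounded above is constant. -/
lemma ConvexOn.eq_of_forall_le {E : Type*} [AddCommGroup E] [Module ℝ E] {f : E → ℝ} {M : ℝ}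
    (hf : ConvexOn ℝ Set.univ f) (hM : ∀ x, f x ≤ M) (x y : E) : f x = f y := by
  have key : ∀ x y, f x ≤ f y := by
    intro x y
    by_contra! hlt
    -- If `f y < f x`, then `x` lies between `y` and the far point `x + N (x - y)`; convexity forces
    -- `f` above `M` there for large `N`.
    obtain ⟨N, hN⟩ := exists_nat_gt ((M - f x) / (f x - f y))
    rw [div_lt_iff₀ (by linarith)] at hN
    have hpos : (0 : ℝ) < N + 1 := by positivity
    have h := hf.2 (Set.mem_univ y) (Set.mem_univ (x + (N : ℝ) • (x - y)))
      (show (0 : ℝ) ≤ N / (N + 1) by positivity) (show (0 : ℝ) ≤ 1 / (N + 1) by positivity)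
      (by field_simp)
    have hx : ((N : ℝ) / (N + 1)) • y + ((1 : ℝ) / (N + 1)) • (x + (N : ℝ) • (x - y)) = x := by
      have h1 : ((1 : ℝ) / (N + 1)) + (1 / (N + 1)) * N = 1 := by field_simp; ring
      have h2 : (N : ℝ) / (N + 1) - (1 / (N + 1)) * N = 0 := by ring
      calc _ = ((1 : ℝ) / (N + 1) + (1 / (N + 1)) * N) • x
            + ((N : ℝ) / (N + 1) - (1 / (N + 1)) * N) • y := by module
        _ = x := by rw [h1, h2]; simp
    rw [hx, smul_eq_mul, smul_eq_mul] at h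
    have h3 := hM (x + (N : ℝ) • (x - y))
    have h4 : (N + 1) * f x ≤ N * f y + M := by
      calc (N + 1) * f x ≤ (N + 1) * (N / (N + 1) * f y
            + 1 / (N + 1) * f (x + (N : ℝ) • (x - y))) := by gcongr
        _ = N * f y + f (x + (N : ℝ) • (x - y)) := by field_simp
        _ ≤ _ := by linarith
    linarith
  exact le_antisymm (key x y) (key y x)

lemma ChainInstance.not_convexOn_localLoss {n T : ℕ} (I : ChainInstance n T) (hT : 0 < T)
    (hr : 0 < I.r) (hlam : 0 < I.lam) (i : Fin n) :
    ¬ ConvexOn ℝ Set.univ (I.problem.localLoss i) := by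
  rw [localLoss_problem]
  intro h
  obtain ⟨x, hx⟩ := exists_chain_neg hT
  have h1 := h.eq_of_forall_le (fun x => (abs_le.1 (I.abs_rescale_chain_le x)).2) 0
    (I.e.symm (I.r • x))
  simp only [rescale, map_zero, smul_zero, LinearIsometryEquiv.apply_symm_apply,
    inv_smul_smul₀ hr.ne'] at h1
  rw [chain_eq_zero (fun j _ => map_zero _), mul_zero] at h1
  nlinarith

/-! ### Progress of a run on the hard instance -/

namespace ChainInstance

variable {n T : ℕ}

/-- The vectors whose coordinates with index greater than `k` vanish. -/
def supported (I : ChainInstance n T) (k : ℕ) : Submodule ℝ (Vec (T + 1)) where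
  carrier := {x | ∀ j, k < j → coord j (I.e x) = 0}
  add_mem' hx hy j hj := by simp [hx j hj, hy j hj]
  zero_mem' j _ := by simp
  smul_mem' c x hx j hj := by simp [hx j hj]

lemma supported_mono (I : ChainInstance n T) {k l : ℕ} (h : k ≤ l) :
    I.supported k ≤ I.supported l := fun _ hx j hj => hx j (h.trans_lt hj)

lemma coord_scaled_eq_zero (I : ChainInstance n T) {k : ℕ} {y : Vec (T + 1)}
    (hy : y ∈ I.supported k) (j : ℕ) (hj : k < j) : coord j (I.r⁻¹ • I.e y) = 0 := by
  rw [map_smul, hy j hj, smul_zero]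

/-- The expectation of coordinate `k + 1` of the stochastic gradient at a point of
`supported k`. -/
noncomputable def frontier (I : ChainInstance n T) (k : ℕ) (y : Vec (T + 1)) : ℝ :=
  -(I.lam / I.r * chainWeight k (coord k (I.r⁻¹ • I.e y)))

/-- Queries made at a lower level are useless at the new one, so contamination can be counted afresh
at every level. -/
lemma frontier_eq_zero (I : ChainInstance n T) {k : ℕ} {y : Vec (T + 1)}
    (hy : y ∈ I.supported k) : I.frontier (k + 1) y = 0 := by
  simp [frontier, I.coord_scaled_eq_zero hy (k + 1) k.lt_succ_self, chainWeight, bump_zero]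

lemma coord_succ_stochGrad (I : ChainInstance n T) {k : ℕ} (hk : k < T) {y : Vec (T + 1)}
    (hy : y ∈ I.supported k) (ξ : Vec 1) :
    coord (k + 1) (I.e (I.problem.stochGrad y ξ)) = coord 0 ξ * I.frontier k y := by
  have h := I.coord_scaled_eq_zero hy
  rw [coord_stochGrad_problem I y ξ (by omega), chainPartial_succ h, chainNoisePartial_succ h,
    frontier]
  ring

lemma stochGrad_mem_supported (I : ChainInstance n T) {k : ℕ} {y : Vec (T + 1)}
    (hy : y ∈ I.supported k) (ξ : Vec I.problem.q) :
    I.problem.stochGrad y ξ ∈ I.supported (k + 1) := by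
  intro j hj
  have h := I.coord_scaled_eq_zero hy
  rcases lt_or_ge j (T + 1) with hjT | hjT
  · refine (coord_stochGrad_problem I y ξ hjT).trans ?_
    rw [chainPartial_eq_zero h hj, chainNoisePartial_eq_zero h hj, mul_zero, add_zero, mul_zero]
  · exact coord_of_le hjT _

/-- The typical sample of node `i`. -/
noncomputable def goodSample (I : ChainInstance n T) (i : Fin n) : Vec I.problem.q :=
  (ofSeq 1 fun _ => I.good i : Vec 1)

lemma coord_succ_stochGrad_goodSample (I : ChainInstance n T) {k : ℕ} (hk : k < T)
    {y : Vec (T + 1)} (hy : y ∈ I.supported k) (i : Fin n) :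
    coord (k + 1) (I.e (I.problem.stochGrad y (I.goodSample i))) = I.good i * I.frontier k y := by
  have h := I.coord_succ_stochGrad hk hy (ofSeq 1 fun _ => I.good i)
  rw [coord_ofSeq one_pos] at h
  exact h

section Run

variable (I : ChainInstance n T) {K : ℝ} {x₀ : Vec (T + 1)} {Ω : Type*} [MeasurableSpace Ω]
  {μ : Measure Ω} (M : MethodRun I.problem (hidingAggregator I.e K I.H) x₀ μ)

/-- The number of atypical samples of the honest nodes in iteration `t`. -/
noncomputable def rareCount (t : ℕ) (ω : Ω) : ℕ :=
  open Classical in ∑ i ∈ I.H, ∑ l : Fin M.m, if M.ξ t i l ω ≠ I.goodSample i then 1 else 0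

lemma query_mem_supported {ω : Ω} {t k : ℕ} (hx : ∀ s ≤ t, M.x s ω ∈ I.supported k)
    (l : Fin M.m) : M.y t l ω ∈ I.supported k := by
  refine Submodule.span_le.2 ?_ (M.query_mem t l ω)
  rintro _ ⟨s, hs, rfl⟩
  exact hx s hs

lemma msg_mem_supported {ω : Ω} {t k : ℕ} (hx : ∀ s ≤ t, M.x s ω ∈ I.supported k) {i : Fin n}
    (hi : i ∈ I.H) : M.v t i ω ∈ I.supported (k + 1) := by
  rw [M.honest_msg t i hi ω]
  refine Submodule.sum_mem _ fun j hj => Submodule.sum_mem _ fun l _ => Submodule.smul_mem _ _ ?_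
  have hj := Finset.mem_range_succ_iff.1 hj
  exact I.stochGrad_mem_supported
    (I.query_mem_supported M (fun s hs => hx s (hs.trans hj)) l) _

lemma aggregate_mem_supported {ω : Ω} {t k : ℕ} (hx : ∀ s ≤ t, M.x s ω ∈ I.supported k) :
    M.w t ω ∈ I.supported (k + 1) := by
  intro j hj
  rcases lt_or_ge j (T + 1) with hjT | hjT
  · rw [M.aggregate, coord_hidingAggregator _ _ _ _ hjT]
    exact hidingMean_eq_zero fun i hi => I.msg_mem_supported M hx hi j hj
  · exact coord_of_le hjT _

open Classical in
/-- The honest nodes that have received an atypical sample in the iterations from `s` to `t`. -/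
noncomputable def contaminated (s t : ℕ) (ω : Ω) : Finset (Fin n) :=
  I.H.filter fun i => ∃ j ∈ Finset.Ico s (t + 1), ∃ l, M.ξ j i l ω ≠ I.goodSample i

lemma mem_contaminated {s t : ℕ} {ω : Ω} {i : Fin n} : i ∈ I.contaminated M s t ω ↔
    i ∈ I.H ∧ ∃ j ∈ Finset.Ico s (t + 1), ∃ l, M.ξ j i l ω ≠ I.goodSample i := by
  simp only [contaminated, Finset.mem_filter]

lemma contaminated_subset (s t : ℕ) (ω : Ω) : I.contaminated M s t ω ⊆ I.H :=
  fun _ hi => ((I.mem_contaminated M).1 hi).1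

lemma card_contaminated_le (s t : ℕ) (ω : Ω) :
    (I.contaminated M s t ω).card ≤ ∑ j ∈ Finset.Ico s (t + 1), I.rareCount M j ω := by
  classical
  have h1 : ∑ j ∈ Finset.Ico s (t + 1), I.rareCount M j ω = ∑ i ∈ I.H,
      ∑ j ∈ Finset.Ico s (t + 1), ∑ l : Fin M.m,
        if M.ξ j i l ω ≠ I.goodSample i then 1 else 0 := by
    unfold rareCount
    rw [Finset.sum_comm]
  rw [h1, contaminated, Finset.card_filter]
  refine Finset.sum_le_sum fun i _ => ?_
  split_ifs with h
  · obtain ⟨j, hj, l, hl⟩ := h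
    refine le_trans ?_ (Finset.single_le_sum (f := fun j => ∑ l : Fin M.m,
      if M.ξ j i l ω ≠ I.goodSample i then 1 else 0) (fun _ _ => Nat.zero_le _) hj)
    refine le_trans ?_ (Finset.single_le_sum (f := fun l : Fin M.m =>
      if M.ξ j i l ω ≠ I.goodSample i then 1 else 0) (fun _ _ => Nat.zero_le _)
      (Finset.mem_univ l))
    simp [hl]
  · exact Nat.zero_le _

/-- As long as few nodes are contaminated, the aggregator hides the next coordinate. -/
lemma aggregate_mem_supported_of_few_contaminated {θ : ℝ}
    (hkill : ∀ (z : Fin n → ℝ) (S : ℝ) (C : Finset (Fin n)), C ⊆ I.H →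
      (C.card : ℝ) < θ * I.H.card → (∀ i ∈ I.H \ C, z i = I.good i * S) →
      meanOn I.H z ^ 2 ≤ K / I.H.card * ∑ i ∈ I.H, (z i - meanOn I.H z) ^ 2)
    {ω : Ω} {s t k : ℕ} (hx : ∀ j ≤ t, M.x j ω ∈ I.supported k)
    (hs : s = 0 ∨ ∃ k', k = k' + 1 ∧ ∀ j < s, M.x j ω ∈ I.supported k')
    (hC : ((I.contaminated M s t ω).card : ℝ) < θ * I.H.card) :
    M.w t ω ∈ I.supported k := by
  classical
  intro j hj
  rcases Nat.lt_or_ge (k + 1) j with hj1 | hj1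
  · exact I.aggregate_mem_supported M hx j hj1
  obtain rfl : j = k + 1 := by omega
  rcases lt_or_ge k T with hkT | hkT
  swap
  · exact coord_of_le (by omega) _
  rw [M.aggregate, coord_hidingAggregator _ _ _ _ (by omega), hidingMean, if_pos]
  -- This `S` does not depend on the node, because query points and coefficients are common.
  refine hkill _ (∑ j ∈ Finset.range (t + 1), ∑ l, M.α t j l ω * I.frontier k (M.y j l ω))
    (I.contaminated M s t ω) (I.contaminated_subset M s t ω) hC fun i hi => ?_
  rw [Finset.mem_sdiff] at hi
  rw [M.honest_msg t i hi.1 ω]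
  simp only [map_sum, map_smul, Finset.mul_sum]
  refine Finset.sum_congr rfl fun j hj => Finset.sum_congr rfl fun l _ => ?_
  have hjt := Finset.mem_range_succ_iff.1 hj
  have hy := I.query_mem_supported M (fun q hq => hx q (hq.trans hjt)) l
  -- Before iteration `s` the queries were one level lower, so even rare samples contribute `0`
  -- there; from `s` on, the node is uncontaminated and its samples are typical.
  rcases lt_or_ge j s with hjs | hjs
  · rcases hs with rfl | ⟨k', rfl, hk'⟩
    · omega
    have hy' := I.query_mem_supported M (fun q hq => hk' q (hq.trans_lt hjs)) l
    rw [I.frontier_eq_zero hy', I.stochGrad_mem_supported hy' _ (k' + 1 + 1) (by omega)]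
    simp
  · have hgood : M.ξ j i l ω = I.goodSample i := by
      by_contra hne
      exact hi.2 ((I.mem_contaminated M).2
        ⟨hi.1, j, Finset.mem_Ico.2 ⟨hjs, by omega⟩, l, hne⟩)
    rw [hgood, I.coord_succ_stochGrad_goodSample hkT hy, smul_eq_mul]
    ring

/-- Every new coordinate costs atypical samples at a fraction `θ` of the honest nodes. -/
lemma exists_level {θ : ℝ}
    (hkill : ∀ (z : Fin n → ℝ) (S : ℝ) (C : Finset (Fin n)), C ⊆ I.H →
      (C.card : ℝ) < θ * I.H.card → (∀ i ∈ I.H \ C, z i = I.good i * S) →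
      meanOn I.H z ^ 2 ≤ K / I.H.card * ∑ i ∈ I.H, (z i - meanOn I.H z) ^ 2)
    (hx₀ : x₀ ∈ I.supported 0) (ω : Ω) (t : ℕ) :
    ∃ k s, s ≤ t ∧ (∀ j ≤ t, M.x j ω ∈ I.supported k) ∧ (∀ j < t, M.w j ω ∈ I.supported k) ∧
      (s = 0 ∨ ∃ k', k = k' + 1 ∧ ∀ j < s, M.x j ω ∈ I.supported k') ∧
      θ * I.H.card * k ≤ ∑ j ∈ Finset.range s, (I.rareCount M j ω : ℝ) := by
  have hstep : ∀ (t k : ℕ), (∀ j ≤ t, M.x j ω ∈ I.supported k) →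
      (∀ j < t + 1, M.w j ω ∈ I.supported k) → ∀ j ≤ t + 1, M.x j ω ∈ I.supported k := by
    intro t k hx hw j hj
    rcases hj.lt_or_eq with hlt | rfl
    · exact hx j (by omega)
    · refine Submodule.span_le.2 ?_ (M.update_mem t ω)
      rintro _ ⟨q, hq, rfl | rfl⟩
      · exact hx q hq
      · exact hw q (by omega)
  -- Invariant: `k` is the current level and `s` the iteration from which its contamination is
  -- counted; the rare samples before `s` pay for all `k` levels.
  induction t with
  | zero =>
    refine ⟨0, 0, le_rfl, fun j hj => ?_, fun j hj => by omega, Or.inl rfl, by simp⟩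
    obtain rfl : j = 0 := by omega
    rw [M.init]
    exact hx₀
  | succ t ih =>
    obtain ⟨k, s, hst, hx, hw, hs, hcount⟩ := ih
    by_cases hC : ((I.contaminated M s t ω).card : ℝ) < θ * I.H.card
    · have hw' : ∀ j < t + 1, M.w j ω ∈ I.supported k := by
        intro j hj
        rcases Nat.lt_succ_iff_lt_or_eq.1 hj with hlt | rfl
        · exact hw j hlt
        · exact I.aggregate_mem_supported_of_few_contaminated M hkill hx hs hC
      exact ⟨k, s, by omega, hstep t k hx hw', hw', hs, hcount⟩
    -- The level rises by one, and counting restarts at `t + 1`. The windows `[s, t + 1)` of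
    -- different levels are disjoint, so their costs add.
    · have hmono := I.supported_mono k.le_succ
      have hw' : ∀ j < t + 1, M.w j ω ∈ I.supported (k + 1) := by
        intro j hj
        rcases Nat.lt_succ_iff_lt_or_eq.1 hj with hlt | rfl
        · exact hmono (hw j hlt)
        · exact I.aggregate_mem_supported M hx
      refine ⟨k + 1, t + 1, le_rfl, hstep t _ (fun j hj => hmono (hx j hj)) hw', hw',
        Or.inr ⟨k, rfl, fun j hj => hx j (by omega)⟩, ?_⟩
      have h1 : ((I.contaminated M s t ω).card : ℝ)
          ≤ ∑ j ∈ Finset.Ico s (t + 1), (I.rareCount M j ω : ℝ) := by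
        exact_mod_cast I.card_contaminated_le M s t ω
      rw [← Finset.sum_range_add_sum_Ico _ (by omega : s ≤ t + 1)]
      push_cast
      linarith [not_lt.1 hC]

lemma coord_out_eq_zero_or_le_sum_rareCount {θ : ℝ} (hθ : 0 ≤ θ)
    (hkill : ∀ (z : Fin n → ℝ) (S : ℝ) (C : Finset (Fin n)), C ⊆ I.H →
      (C.card : ℝ) < θ * I.H.card → (∀ i ∈ I.H \ C, z i = I.good i * S) →
      meanOn I.H z ^ 2 ≤ K / I.H.card * ∑ i ∈ I.H, (z i - meanOn I.H z) ^ 2)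
    (hx₀ : x₀ ∈ I.supported 0) (ω : Ω) (t : ℕ) :
    coord T (I.e (M.out t ω)) = 0 ∨
      θ * I.H.card * T ≤ ∑ j ∈ Finset.range t, (I.rareCount M j ω : ℝ) := by
  obtain ⟨k, s, hst, hx, -, -, hcount⟩ := I.exists_level M hkill hx₀ ω t
  rcases lt_or_ge k T with hk | hk
  · left
    have : M.out t ω ∈ I.supported k := by
      refine Submodule.span_le.2 ?_ (M.out_mem t ω)
      rintro _ ⟨q, hq, rfl⟩
      exact hx q hq
    exact this T hk
  · right
    have hk' : (T : ℝ) ≤ k := by exact_mod_cast hk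
    calc θ * I.H.card * T ≤ θ * I.H.card * k := by gcongr
      _ ≤ _ := hcount
      _ ≤ _ := Finset.sum_le_sum_of_subset_of_nonneg (Finset.range_mono hst)
        fun _ _ _ => Nat.cast_nonneg _

lemma norm_gradient_loss_ge (hT : 0 < T) (hr : 0 < I.r) (hlam : 0 < I.lam) {x : Vec (T + 1)}
    (hx : coord T (I.e x) = 0) : I.lam / I.r / 4 ≤ ‖gradient I.problem.loss x‖ := by
  rw [loss_problem, gradient_chain_rescale, norm_smul, LinearIsometryEquiv.norm_map,
    Real.norm_of_nonneg (by positivity)]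
  have h := quarter_le_norm_chainPartial hT (x := I.r⁻¹ • I.e x) (by simp [hx])
  have h2 : 0 < I.lam / I.r := by positivity
  nlinarith

end Run

end ChainInstance

/-! ### The expected number of queries -/

lemma sum_range_eq_tsum_indicator {Ω : Type*} (τ : Ω → ℕ) (R : ℕ → Ω → ENNReal) (ω : Ω) :
    ∑ s ∈ Finset.range (τ ω), R s ω = ∑' s, ({ω | τ ω ≤ s}ᶜ : Set Ω).indicator (R s) ω := by
  rw [tsum_eq_sum (s := Finset.range (τ ω))]
  · refine Finset.sum_congr rfl fun s hs => ?_
    rw [Set.indicator_of_mem]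
    simpa using hs
  · intro s hs
    rw [Set.indicator_of_notMem]
    simpa using hs

lemma measurable_sum_range {Ω : Type*} [MeasurableSpace Ω] {τ : Ω → ℕ}
    (hτ : ∀ s, MeasurableSet {ω | τ ω ≤ s}) {R : ℕ → Ω → ENNReal} (hR : ∀ s, Measurable (R s)) :
    Measurable fun ω => ∑ s ∈ Finset.range (τ ω), R s ω := by
  simp only [sum_range_eq_tsum_indicator]
  exact Measurable.tsum fun s => (hR s).indicator (hτ s).compl

lemma lintegral_sum_range {Ω : Type*} [MeasurableSpace Ω] {μ : Measure Ω} {τ : Ω → ℕ}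
    (hτ : ∀ s, MeasurableSet {ω | τ ω ≤ s}) {R : ℕ → Ω → ENNReal} (hR : ∀ s, Measurable (R s)) :
    ∫⁻ ω, ∑ s ∈ Finset.range (τ ω), R s ω ∂μ = ∑' s, ∫⁻ ω in {ω | τ ω ≤ s}ᶜ, R s ω ∂μ := by
  simp only [sum_range_eq_tsum_indicator]
  rw [lintegral_tsum fun s => ((hR s).indicator (hτ s).compl).aemeasurable]
  exact tsum_congr fun s => lintegral_indicator (hτ s).compl _

/-- Wald's inequality. -/
lemma lintegral_sum_range_le {Ω : Type*} [MeasurableSpace Ω] {μ : Measure Ω} {τ : Ω → ℕ}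
    (hτ : ∀ s, MeasurableSet {ω | τ ω ≤ s}) {R : ℕ → Ω → ENNReal} (hR : ∀ s, Measurable (R s))
    {c : ENNReal} (hc : ∀ s, ∫⁻ ω in {ω | τ ω ≤ s}ᶜ, R s ω ∂μ ≤ c * μ {ω | τ ω ≤ s}ᶜ) :
    ∫⁻ ω, ∑ s ∈ Finset.range (τ ω), R s ω ∂μ ≤ c * ∫⁻ ω, (τ ω : ENNReal) ∂μ := by
  have h1 : ∫⁻ ω, (τ ω : ENNReal) ∂μ = ∑' s, μ {ω | τ ω ≤ s}ᶜ := by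
    have := lintegral_sum_range (μ := μ) hτ (R := fun _ _ => 1) fun _ => measurable_const
    simpa using this
  rw [lintegral_sum_range hτ hR, h1, ← ENNReal.tsum_mul_left]
  exact ENNReal.tsum_le_tsum hc

namespace ChainInstance

variable {n T : ℕ} (I : ChainInstance n T) {A : (Fin n → Vec (T + 1)) → Vec (T + 1)} {K : ℝ}
  {x₀ : Vec (T + 1)} {Ω : Type*} [MeasurableSpace Ω] {μ : Measure Ω}

lemma measurable_sample (M : MethodRun I.problem A x₀ μ) (t : ℕ) (i : Fin n) (l : Fin M.m) :
    Measurable (M.ξ t i l) :=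
  (M.measurable_ξ t i l).mono (M.𝓖.le _) le_rfl

lemma measurableSet_rare (i : Fin n) : MeasurableSet {ξ : Vec I.problem.q | ξ ≠ I.goodSample i} :=
  (measurableSet_singleton _).compl

/-- The probability of an atypical sample. -/
lemma measure_rare_le (M : MethodRun I.problem A x₀ μ) (t : ℕ) {i : Fin n} (hi : i ∈ I.H)
    (l : Fin M.m) : μ {ω | M.ξ t i l ω ≠ I.goodSample i} ≤ ENNReal.ofReal I.p := by
  have hprob := I.problem.prob
  have hmeas : Measurable fun ω (p : I.problem.H × Fin M.m) => M.ξ t p.1 p.2 ω :=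
    measurable_pi_lambda _ fun p => I.measurable_sample M t p.1 p.2
  have hmap : μ.map (M.ξ t i l) = I.problem.D i := by
    have h1 := (measurePreserving_eval
      (fun p : I.problem.H × Fin M.m => I.problem.D p.1) (⟨i, hi⟩, l)).map_eq
    rw [← M.law_ξ t, Measure.map_map (measurable_pi_apply _) hmeas] at h1
    exact h1
  have h2 : μ {ω | M.ξ t i l ω ≠ I.goodSample i}
      = I.problem.D i {ξ | ξ ≠ I.goodSample i} := by
    rw [← hmap, Measure.map_apply (I.measurable_sample M t i l) (I.measurableSet_rare i)]
    rfl
  rw [h2]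
  exact twoPoint_ne_le _ _ _

lemma measure_inter_rare_le (M : MethodRun I.problem A x₀ μ) (t : ℕ) {i : Fin n} (hi : i ∈ I.H)
    (l : Fin M.m) {s : Set Ω} (hs : MeasurableSet[M.𝓖 t] s) :
    μ ({ω | M.ξ t i l ω ≠ I.goodSample i} ∩ s) ≤ ENNReal.ofReal I.p * μ s := by
  have hB : MeasurableSet[MeasurableSpace.comap
      (fun ω (p : I.problem.H × Fin M.m) => M.ξ t p.1 p.2 ω) inferInstance]
      {ω | M.ξ t i l ω ≠ I.goodSample i} := by
    refine ⟨{z | z (⟨i, hi⟩, l) ≠ I.goodSample i}, ?_, rfl⟩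
    have hm : Measurable fun z : I.problem.H × Fin M.m → Vec I.problem.q => z (⟨i, hi⟩, l) :=
      measurable_pi_apply _
    exact hm (I.measurableSet_rare i)
  rw [(Indep_iff _ _ μ).1 (M.indep_ξ t) _ _ hB hs]
  gcongr
  exact I.measure_rare_le M t hi l

lemma rareCount_eq (M : MethodRun I.problem (hidingAggregator I.e K I.H) x₀ μ) (t : ℕ) (ω : Ω) :
    (I.rareCount M t ω : ENNReal) = ∑ i ∈ I.H, ∑ l : Fin M.m,
      ({ω | M.ξ t i l ω ≠ I.goodSample i}.indicator 1 ω : ENNReal) := by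
  classical
  simp only [rareCount, Set.indicator_apply, Set.mem_ofPred_eq, Pi.one_apply]
  push_cast
  rfl

lemma measurableSet_rare_sample (M : MethodRun I.problem A x₀ μ) (t : ℕ) (i : Fin n)
    (l : Fin M.m) : MeasurableSet {ω | M.ξ t i l ω ≠ I.goodSample i} :=
  I.measurable_sample M t i l (I.measurableSet_rare i)

lemma measurable_rareCount (M : MethodRun I.problem (hidingAggregator I.e K I.H) x₀ μ) (t : ℕ) :
    Measurable fun ω => (I.rareCount M t ω : ENNReal) := by
  simp only [rareCount_eq]
  exact Finset.measurable_fun_sum _ fun i _ => Finset.measurable_fun_sum _ fun l _ =>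
    measurable_one.indicator (I.measurableSet_rare_sample M t i l)

lemma setLIntegral_rareCount_le (M : MethodRun I.problem (hidingAggregator I.e K I.H) x₀ μ)
    (t : ℕ) {s : Set Ω} (hs : MeasurableSet[M.𝓖 t] s) :
    ∫⁻ ω in s, (I.rareCount M t ω : ENNReal) ∂μ
      ≤ I.H.card * M.m * ENNReal.ofReal I.p * μ s := by
  simp only [rareCount_eq]
  rw [lintegral_finsetSum _ fun i _ => Finset.measurable_fun_sum _ fun l _ =>
    measurable_one.indicator (I.measurableSet_rare_sample M t i l)]
  have h : ∀ i ∈ I.H, ∫⁻ ω in s, ∑ l : Fin M.m,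
      ({ω | M.ξ t i l ω ≠ I.goodSample i}.indicator 1 ω : ENNReal) ∂μ
        ≤ M.m * (ENNReal.ofReal I.p * μ s) := by
    intro i hi
    rw [lintegral_finsetSum _ fun l _ =>
      measurable_one.indicator (I.measurableSet_rare_sample M t i l)]
    refine (Finset.sum_le_card_nsmul _ _ (ENNReal.ofReal I.p * μ s) fun l _ => ?_).trans ?_
    · rw [lintegral_indicator_one (I.measurableSet_rare_sample M t i l),
        Measure.restrict_apply (I.measurableSet_rare_sample M t i l)]
      exact I.measure_inter_rare_le M t hi l hs
    · simp
  refine (Finset.sum_le_card_nsmul _ _ _ h).trans ?_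
  rw [nsmul_eq_mul]
  exact le_of_eq (by ring)

lemma le_lintegral_queries (M : MethodRun I.problem (hidingAggregator I.e K I.H) x₀ μ)
    [IsProbabilityMeasure μ] {θ ε : ℝ} (hθ : 0 ≤ θ) (hε : 0 < ε)
    (hkill : ∀ (z : Fin n → ℝ) (S : ℝ) (C : Finset (Fin n)), C ⊆ I.H →
      (C.card : ℝ) < θ * I.H.card → (∀ i ∈ I.H \ C, z i = I.good i * S) →
      meanOn I.H z ^ 2 ≤ K / I.H.card * ∑ i ∈ I.H, (z i - meanOn I.H z) ^ 2)
    (hx₀ : x₀ ∈ I.supported 0) (hT : 0 < T) (hr : 0 < I.r) (hlam : 0 < I.lam)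
    (hscale : I.lam / I.r = 8 * ε) {τ : Ω → ℕ}
    (hτ : ∀ t : ℕ, MeasurableSet[M.𝓖 t] {ω | τ ω ≤ t})
    (hout : ∫⁻ ω, ‖gradient I.problem.loss (M.out (τ ω) ω)‖ₑ ∂μ ≤ ENNReal.ofReal ε) :
    ENNReal.ofReal (θ * T / (2 * I.p)) ≤ ∫⁻ ω, ((M.m * τ ω : ℕ) : ENNReal) ∂μ := by
  have hp := I.p_pos
  have hh : (0 : ℝ) < I.H.card := by exact_mod_cast I.card_H_pos
  have hτ' : ∀ s, MeasurableSet {ω | τ ω ≤ s} := fun s => M.𝓖.le s _ (hτ s)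
  set count : Ω → ENNReal := fun ω => ∑ s ∈ Finset.range (τ ω), (I.rareCount M s ω : ENNReal)
  have hcount : Measurable count := measurable_sum_range hτ' (I.measurable_rareCount M)
  set X := ∫⁻ ω, ((M.m * τ ω : ℕ) : ENNReal) ∂μ with hX
  have hwald : ∫⁻ ω, count ω ∂μ ≤ ENNReal.ofReal (I.H.card * I.p) * X := by
    refine (lintegral_sum_range_le hτ' (I.measurable_rareCount M)
      fun s => I.setLIntegral_rareCount_le M s (hτ s).compl).trans ?_
    have h1 : X = M.m * ∫⁻ ω, (τ ω : ENNReal) ∂μ := by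
      rw [hX, ← lintegral_const_mul' _ _ (ENNReal.natCast_ne_top _)]
      simp
    rw [h1, ENNReal.ofReal_mul hh.le, ENNReal.ofReal_natCast]
    exact le_of_eq (by ring)
  -- Markov's inequality in linear form: either the gradient norm is at least `2ε`, or the number of
  -- rare samples is at least `θ|H|T`. Only the count has to be measurable when this is integrated.
  have hpoint : ∀ ω, ENNReal.ofReal (2 * ε * (θ * I.H.card * T))
      ≤ ENNReal.ofReal (θ * I.H.card * T) * ‖gradient I.problem.loss (M.out (τ ω) ω)‖ₑ
        + ENNReal.ofReal (2 * ε) * count ω := by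
    intro ω
    rw [ENNReal.ofReal_mul (by positivity)]
    rcases I.coord_out_eq_zero_or_le_sum_rareCount M hθ hkill hx₀ ω (τ ω) with h | h
    · have h1 := I.norm_gradient_loss_ge hT hr hlam h
      rw [hscale] at h1
      refine le_add_of_le_of_nonneg ?_ zero_le
      rw [mul_comm, ← ofReal_norm]
      gcongr
      linarith
    · refine le_add_of_nonneg_of_le zero_le ?_
      gcongr
      refine (ENNReal.ofReal_le_ofReal h).trans (le_of_eq ?_)
      rw [ENNReal.ofReal_sum_of_nonneg fun _ _ => Nat.cast_nonneg _]
      simp [count]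
  have hint := lintegral_mono (μ := μ) hpoint
  rw [lintegral_const, measure_univ, mul_one, lintegral_add_right _ (hcount.const_mul _),
    lintegral_const_mul' _ _ ENNReal.ofReal_ne_top, lintegral_const_mul _ hcount] at hint
  by_cases hXtop : X = ⊤
  · rw [hXtop]; exact le_top
  have hle : ENNReal.ofReal (2 * ε * (θ * I.H.card * T))
      ≤ ENNReal.ofReal (θ * I.H.card * T) * ENNReal.ofReal ε
        + ENNReal.ofReal (2 * ε) * (ENNReal.ofReal (I.H.card * I.p) * ENNReal.ofReal X.toReal) := by
    rw [ENNReal.ofReal_toReal hXtop]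
    exact hint.trans (by gcongr)
  have hX0 : 0 ≤ X.toReal := ENNReal.toReal_nonneg
  rw [← ENNReal.ofReal_mul (by positivity), ← ENNReal.ofReal_mul (by positivity),
    ← ENNReal.ofReal_mul (by positivity), ← ENNReal.ofReal_add (by positivity) (by positivity),
    ENNReal.ofReal_le_ofReal_iff (by positivity)] at hle
  rw [← ENNReal.ofReal_toReal hXtop]
  refine ENNReal.ofReal_le_ofReal ?_
  rw [div_le_iff₀ (by positivity)]
  have h1 : (ε * I.H.card) * (θ * T) ≤ (ε * I.H.card) * (X.toReal * (2 * I.p)) := by linarith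
  exact le_of_mul_le_mul_left h1 (by positivity)

end ChainInstance

/-! ### The lower bound -/

/-- A rotation that maps a given vector to the first coordinate axis. -/
lemma exists_rotation {d : ℕ} (x₀ : Vec (d + 1)) :
    ∃ e : Vec (d + 1) ≃ₗᵢ[ℝ] Vec (d + 1), ∀ j, 0 < j → coord j (e x₀) = 0 := by
  rcases eq_or_ne x₀ 0 with rfl | hx
  · exact ⟨LinearIsometryEquiv.refl ℝ _, fun j _ => by simp⟩
  set v : Fin (d + 1) → Vec (d + 1) := fun _ => ‖x₀‖⁻¹ • x₀ with hv
  have hnorm : ‖‖x₀‖⁻¹ • x₀‖ = 1 := by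
    rw [norm_smul, norm_inv, norm_norm, inv_mul_cancel₀ (norm_ne_zero_iff.2 hx)]
  -- Only index `0` is prescribed, so the constant family `v` suffices.
  have horth : Orthonormal ℝ (({0} : Set (Fin (d + 1))).domRestrict v) := by
    refine ⟨fun _ => hnorm, ?_⟩
    rintro ⟨i, rfl⟩ ⟨j, rfl⟩ hij
    exact absurd rfl hij
  obtain ⟨b, hb⟩ := horth.exists_orthonormalBasis_extension_of_card_eq (by simp)
  refine ⟨b.repr, fun j hj => ?_⟩
  rcases lt_or_ge j (d + 1) with hjd | hjd
  swap
  · exact coord_of_le hjd _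
  have hx₀ : x₀ = ‖x₀‖ • b 0 := by
    rw [hb 0 rfl, hv, smul_smul, mul_inv_cancel₀ (norm_ne_zero_iff.2 hx), one_smul]
  have hne : (⟨j, hjd⟩ : Fin (d + 1)) ≠ 0 := fun h => by
    have := congrArg Fin.val h
    simp at this
    omega
  rw [coord_of_lt hjd, b.repr_apply_apply, hx₀, inner_smul_right, b.orthonormal.2 hne, mul_zero]

/-- An honest majority of the smallest admissible size. -/
lemma exists_honest_set {n : ℕ} {δ : ℝ} (hn : 2 ≤ n) (h0 : 0 ≤ δ) (h1 : δ < 1 / 2) :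
    ∃ H : Finset (Fin n), (1 - δ) * n ≤ H.card ∧ Hᶜ.card < H.card ∧ 2 ≤ H.card := by
  have hn' : (2 : ℝ) ≤ n := by exact_mod_cast hn
  have hle : ⌈(1 - δ) * n⌉₊ ≤ n := Nat.ceil_le.2 (by nlinarith)
  obtain ⟨H, -, hH⟩ := Finset.exists_subset_card_eq (s := (Finset.univ : Finset (Fin n)))
    (n := ⌈(1 - δ) * n⌉₊) (by simpa using hle)
  have hc : (1 - δ) * n ≤ H.card := by rw [hH]; exact Nat.le_ceil _
  have hmaj : n < 2 * H.card := by
    have : (n : ℝ) < 2 * H.card := by nlinarith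
    exact_mod_cast this
  refine ⟨H, hc, ?_, by omega⟩
  rw [Finset.card_compl, Fintype.card_fin]
  omega

/-- Scaling by `Δ / D` with the exact infimum `-D` makes the gap equal to `Δ`, not merely bounded by
it. -/
lemma exists_isGLB_chain {T : ℕ} (hT : 0 < T) :
    ∃ D : ℝ, 0 < D ∧ D ≤ 4 * T ∧ IsGLB (Set.range (chain T)) (-D) := by
  have hlow : ∀ x, -(4 * (T : ℝ)) ≤ chain T x := fun x => (abs_le.1 (abs_chain_le T x)).1
  have hbdd : BddBelow (Set.range (chain T)) := ⟨_, by rintro _ ⟨x, rfl⟩; exact hlow x⟩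
  have hglb := isGLB_csInf (Set.range_nonempty (chain T)) hbdd
  obtain ⟨x, hx⟩ := exists_chain_neg hT
  refine ⟨-sInf (Set.range (chain T)), ?_, ?_, by rwa [neg_neg]⟩
  · linarith [hglb.1 ⟨x, rfl⟩]
  · linarith [hglb.2 (show -(4 * (T : ℝ)) ∈ lowerBounds (Set.range (chain T)) by
      rintro _ ⟨x, rfl⟩; exact hlow x)]

lemma ChainInstance.isGLB_loss {n T : ℕ} (I : ChainInstance n T) (hr : 0 < I.r)
    (hlam : 0 < I.lam) {D : ℝ} (hD : IsGLB (Set.range (chain T)) (-D)) {x₀ : Vec (T + 1)}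
    (hx₀ : x₀ ∈ I.supported 0) :
    IsGLB (Set.range I.problem.loss) (I.problem.loss x₀ - I.lam * D) := by
  rw [loss_problem]
  have h0 : rescale I.e I.lam I.r (chain T) x₀ = 0 := by
    rw [rescale, chain_eq_zero (I.coord_scaled_eq_zero hx₀), mul_zero]
  rw [h0]
  constructor
  · rintro _ ⟨x, rfl⟩
    have := mul_le_mul_of_nonneg_left (hD.1 ⟨I.r⁻¹ • I.e x, rfl⟩) hlam.le
    simp only [rescale]
    linarith
  · intro b hb
    have h1 : b / I.lam ≤ -D := by
      refine hD.2 ?_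
      rintro _ ⟨x, rfl⟩
      have h := hb ⟨I.e.symm (I.r • x), rfl⟩
      simp only [rescale, LinearIsometryEquiv.apply_symm_apply, inv_smul_smul₀ hr.ne'] at h
      rw [div_le_iff₀ hlam]
      linarith
    rw [div_le_iff₀ hlam] at h1
    linarith

theorem lemma7 :
    -- absolute constants
    ∃ c₀ > (0 : ℝ), ∃ c > (0 : ℝ),
    ∀ (n : ℕ) (L Δ σ ρ δ δmax ε : ℝ), 2 ≤ n → 0 < L → 0 < Δ → 0 < σ → 0 < ρ →
      0 ≤ δ → δ ≤ δmax → δmax < 1 / 2 → 0 < ε → ε ^ 2 ≤ c₀ * (L * Δ) →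
    ∃ d : ℕ, ∀ x₀ : Vec d,
    ∃ (P : DistProblem n d) (A : (Fin n → Vec d) → Vec d),
      (1 - δ) * n ≤ P.H.card ∧
      P.InFunctionClass L 0 ∧
      (∀ i ∈ P.H, ¬ ConvexOn ℝ Set.univ (P.localLoss i)) ∧
      IsGLB (Set.range P.loss) (P.loss x₀ - Δ) ∧
      P.InOracleClass (σ ^ 2) ∧
      IsRobustAggregator ρ δ P.H A ∧
      -- every method, stopped at any stopping time `τ` (in particular after a fixed number
      -- of iterations) whose output is `ε`-stationary in expectation, makes many queries
      ∀ (Ω : Type*) [MeasurableSpace Ω] (μ : Measure Ω) [IsProbabilityMeasure μ]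
        (M : MethodRun P A x₀ μ) (τ : Ω → ℕ),
        (∀ t : ℕ, MeasurableSet[M.𝓖 t] {ω | τ ω ≤ t}) →
        ∫⁻ ω, ‖gradient P.loss (M.out (τ ω) ω)‖ₑ ∂μ ≤ ENNReal.ofReal ε →
        ENNReal.ofReal (c * (L * Δ * ρ * δ * σ ^ 2 / ε ^ 4))
          ≤ ∫⁻ ω, ((M.m * τ ω : ℕ) : ENNReal) ∂μ := by
  refine ⟨1 / 2816, by norm_num, 1 / (72 * 5632 * 4032), by norm_num, ?_⟩
  intro n L Δ σ ρ δ δmax ε hn hL hΔ hσ hρ hδ0 hδ hδmax hε hε2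
  have hK : 0 ≤ ρ * δ := by positivity
  obtain ⟨H, hH, hmaj, hH2⟩ := exists_honest_set hn hδ0 (hδ.trans_lt hδmax)
  obtain ⟨good, η, θ, hη, hθ, hgood, hηθ, hkill⟩ := exists_typical_factors hK hH2
  -- With `lam = Δ / D`, `D ≤ 4T` and `lam / r = 8ε`, the smoothness constant is `11 * lam / r² =
  -- 704 ε² D / Δ ≤ 2816 ε² T / Δ`, so `T = ⌊q⌋` is admissible. The constant `c₀` ensures `T ≥ 1`.
  set q := L * Δ / (2816 * ε ^ 2) with hq
  have hq1 : 1 ≤ q := by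
    rw [hq, le_div_iff₀ (by positivity)]; linarith
  have hTq : (⌊q⌋₊ : ℝ) ≤ q := Nat.floor_le (by linarith)
  have hqT : q < ⌊q⌋₊ + 1 := Nat.lt_floor_add_one q
  have hT : 0 < ⌊q⌋₊ := Nat.floor_pos.2 hq1
  generalize ⌊q⌋₊ = T at hTq hqT hT
  have hT1 : (1 : ℝ) ≤ T := by exact_mod_cast hT
  obtain ⟨D, hD0, hD4, hD⟩ := exists_isGLB_chain hT
  refine ⟨T + 1, fun x₀ => ?_⟩
  obtain ⟨e, he⟩ := exists_rotation x₀
  -- `4032 = 8² * 63`: the squared gradient scale times the bound for the noise potential. If the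
  -- minimum is `1`, the noise is degenerate and its variance is `0`.
  set p := min 1 (4032 * η ^ 2 * ε ^ 2 / σ ^ 2) with hp
  have hp0 : 0 < p := lt_min one_pos (by positivity)
  let I : ChainInstance n T := {
    e := e
    lam := Δ / D
    r := Δ / D / (8 * ε)
    p := p
    good := good
    H := H
    p_pos := hp0
    p_le_one := min_le_left _ _
    majority := hmaj }
  have hlam : 0 < I.lam := div_pos hΔ hD0
  have hr : 0 < I.r := div_pos hlam (by positivity)
  have hscale : I.lam / I.r = 8 * ε := div_div_cancel₀ hlam.ne'
  have hx₀ : x₀ ∈ I.supported 0 := he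
  refine ⟨I.problem, hidingAggregator e (ρ * δ) H, hH, ?_, ?_, ?_, ?_, ?_, ?_⟩
  · refine I.inFunctionClass_problem hr hlam ?_
    have h1 : 2816 * ε ^ 2 * T ≤ L * Δ := by
      rw [hq, le_div_iff₀ (by positivity)] at hTq
      linarith
    have h2 : 704 * ε ^ 2 ≤ L * I.lam := by
      change 704 * ε ^ 2 ≤ L * (Δ / D)
      rw [mul_div_assoc', le_div_iff₀ hD0]
      nlinarith [mul_le_mul_of_nonneg_left hD4 (by positivity : 0 ≤ 704 * ε ^ 2)]
    have h3 : I.lam = I.r * (8 * ε) := by rw [← hscale, mul_div_cancel₀ _ hr.ne']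
    have h4 : 88 * ε ≤ L * I.r := by
      rw [h3] at h2
      have : (8 * ε) * (88 * ε) ≤ (8 * ε) * (L * I.r) := by linarith
      exact le_of_mul_le_mul_left this (by positivity)
    nlinarith
  · exact fun i _ => I.not_convexOn_localLoss hT hr hlam i
  · have h := I.isGLB_loss hr hlam hD hx₀
    have h1 : I.lam * D = Δ := div_mul_cancel₀ _ hD0.ne'
    rwa [h1] at h
  · refine I.inOracleClass_problem hgood ?_
    rw [hscale]
    change (8 * ε) ^ 2 * 63 * η ^ 2 * (1 - p) ≤ σ ^ 2 * p
    rcases min_choice 1 (4032 * η ^ 2 * ε ^ 2 / σ ^ 2) with h | h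
    · rw [hp, h, sub_self, mul_zero]; positivity
    · have h1 : σ ^ 2 * p = 4032 * η ^ 2 * ε ^ 2 := by
        rw [hp, h, mul_div_cancel₀ _ (by positivity)]
      rw [h1]
      nlinarith [mul_nonneg (by positivity : 0 ≤ 4032 * η ^ 2 * ε ^ 2) hp0.le]
  · exact isRobustAggregator_hidingAggregator e hK hH
  · intro Ω _ μ _ M τ hτ hout
    refine le_trans (ENNReal.ofReal_le_ofReal ?_)
      (I.le_lintegral_queries M hθ hε hkill hx₀ hT hr hlam hscale hτ hout)
    change _ ≤ θ * T / (2 * p)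
    have hp2 : p * σ ^ 2 ≤ 4032 * η ^ 2 * ε ^ 2 := by
      rw [← le_div_iff₀ (by positivity)]
      exact min_le_right _ _
    -- Rounding down loses at most a factor `2`, because `q < T + 1 ≤ 2T`.
    have hT2 : L * Δ ≤ 5632 * ε ^ 2 * T := by
      have : q ≤ 2 * T := by linarith
      rw [hq, div_le_iff₀ (by positivity)] at this
      linarith
    rw [le_div_iff₀ (by positivity)]
    calc 1 / (72 * 5632 * 4032) * (L * Δ * ρ * δ * σ ^ 2 / ε ^ 4) * (2 * p)
        = (ρ * δ) * (L * Δ) * (p * σ ^ 2) / (36 * 5632 * 4032 * ε ^ 4) := by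
          field_simp; ring
      _ ≤ (ρ * δ) * (5632 * ε ^ 2 * T) * (4032 * η ^ 2 * ε ^ 2) / (36 * 5632 * 4032 * ε ^ 4) := by
          gcongr
      _ = ρ * δ * η ^ 2 * T / 36 := by field_simp
      _ ≤ 36 * θ * T / 36 := by gcongr
      _ = θ * T := by ring
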